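/- **Theorem 2.** Consider the following extended Stahl market. Finitely many sellers $i$ own $n_i\ge 1$ stores each, $N=\sum_i n_i$, and every seller charges one price in all of its stores; production is free, and admissible prices are those in $[0,M]$, $M>0$. There is a unit mass of buyers, each buying one unit. A fraction $\mu\in(0,1)$ are shoppers, who buy at a cheapest store, each cheapest store being equally likely. The others are searchers with a common reserve price $P_M$: a searcher visits for free a uniformly drawn store, buys there if its price is at most $P_M$, and otherwise goes on, at a cost $c>0$ per visit, to a store drawn uniformly among the stores of the sellers not visited so far, by the same rule; if all sellers have been visited and all prices exceed $P_M$, the searcher buys at a cheapest visited store, ties being broken with weights $n_i$. The reserve price lies in $[0,M]$, and every admissible price below $c$ is accepted under it. Sellers choose independently (mixed) pricing strategies, i.e. probability distributions on $[0,M]$. A profile of strategies is a *seller equilibrium with reserve price $P_M$* if no seller can increase its expected profit (price times quantity sold) by a unilateral change of strategy. Every Nash equilibrium of the game with reserve price $P_M$ has this property; the optimality of $P_M$ for the searchers, which a Nash equilibrium requires in addition, is not needed below. Let $n_m=\min_i n_i$ and suppose that the set $S$ of sellers with $n_m$ stores has $k\ge 2$ elements. Then every seller equilibrium with reserve price $P_M$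 has the following properties. 1. Every seller with more than $n_m$ stores chooses $P_M$ as a pure strategy. 2. The strategies of the sellers in $S$ form a seller equilibrium with reserve price $P_M$ of the original Stahl market (one store per seller) with the $k$ sellers in $S$, in which the buyers are all shoppers and only those searchers whose first visit is to a seller in $S$; after normalization of the total mass of buyers to one, the fraction of shoppers in this market is $\mu'=\mu/\bigl(\mu+(1-\mu)kn_m/N\bigr)$. Moreover, with $P_L=P_M\frac{1-\mu'}{(k-1)\mu'+1}$, there is an atomless distribution $\nu$ with support $[P_L,P_M]$ such that at least two sellers in $S$ use $\nu$, and every seller in $S$ either uses $\nu$, or chooses $P_M$ purely, or has an individual cutoff price $q\in(P_L,P_M)$, in which case its strategy coincides with $\nu$ below $q$ and puts the remaining mass $\nu([q,\infty))$ on $P_M$. In the reduced market all sellers in $S$ have the profit $P_M(1-\mu')/k$. 3. The expected profit of every seller $i$ is $\frac{P_M(1-\mu)}{N}\,n_i$, that is, a constant times $n_i$. 4. Almost surely, every realized price is at most $P_M$, so that every searcher buys at the first store visited. -/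

import Mathlib

open MeasureTheory

noncomputable section

/-- The data of an extended Stahl market with set of sellers `ι`: the fraction `shoppers` of shoppers
in the unit mass of buyers (the others are searchers), the cost of an additional search, the upper
bound on prices, and the number of stores of each seller. The original Stahl market is the case
in which all sellers have one store. -/
structure StahlMarket (ι : Type*) where
  shoppers : ℝ
  searchCost : ℝ
  maxPrice : ℝ
  stores : ι → ℕ

namespace StahlMarket

variable {ι : Type*}

/-- Standing assumptions on the parameters. -/
structure IsValid (m : StahlMarket ι) : Prop where
  shoppers_pos : 0 < m.shoppers
  shoppers_lt_one : m.shoppers < 1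
  searchCost_pos : 0 < m.searchCost
  maxPrice_pos : 0 < m.maxPrice
  stores_pos : ∀ i, 0 < m.stores i

/-- A (mixed) pricing strategy: a probability distribution on the admissible prices. -/
def IsStrategy (m : StahlMarket ι) (τ : Measure ℝ) : Prop :=
  IsProbabilityMeasure τ ∧ τ (Set.Icc 0 m.maxPrice)ᶜ = 0

/-- A reserve price is an admissible price, and every admissible price below the search cost
is accepted under it. -/
def IsReservePrice (m : StahlMarket ι) (r : ℝ) : Prop :=
  r ∈ Set.Icc 0 m.maxPrice ∧ ∀ p ∈ Set.Icc 0 m.maxPrice, p < m.searchCost → p ≤ r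

variable [Fintype ι] [DecidableEq ι]

/-- The total number of stores. -/
def totalStores (m : StahlMarket ι) : ℝ := ∑ i, (m.stores i : ℝ)

/-- The share obtained by seller `i` among buyers who know all realized prices `p` and buy at a
cheapest store, all cheapest stores being equally likely. -/
def cheapestShare (m : StahlMarket ι) (p : ι → ℝ) (i : ι) : ℝ :=
  if ∀ j, p i ≤ p j then
    (m.stores i : ℝ) / ∑ j with ∀ k, p j ≤ p k, (m.stores j : ℝ)
  else 0

/-- The probability that a searcher with reserve price `r` who is currently at a store of seller `j`,
has rejected all sellers outside `R ∪ {j}` and has not yet visited those in `R`, finally buys from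
seller `i`: a price weakly below `r` is accepted; otherwise one of the stores of
the unvisited sellers is drawn uniformly; once all sellers have been visited without success,
the searcher returns to a cheapest one. -/
def buyFrom (m : StahlMarket ι) (r : ℝ) (p : ι → ℝ) (j : ι) (R : Finset ι) (i : ι) : ℝ :=
  if p j ≤ r then (if i = j then 1 else 0)
  else if R = ∅ then m.cheapestShare p i
  else ∑ k : {k // k ∈ R},
    (m.stores k.1 : ℝ) / (∑ l ∈ R, (m.stores l : ℝ)) * m.buyFrom r p k.1 (R.erase k.1) i
termination_by R.card
decreasing_by exact Finset.card_erase_lt_of_mem k.2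

/-- The share of searchers who buy from seller `i` at realized prices `p`; the first store is drawn
uniformly among all stores. -/
def searcherShare (m : StahlMarket ι) (r : ℝ) (p : ι → ℝ) (i : ι) : ℝ :=
  ∑ j, (m.stores j : ℝ) / m.totalStores * m.buyFrom r p j (Finset.univ.erase j) i

/-- The quantity sold by seller `i` at realized prices `p`. -/
def quantity (m : StahlMarket ι) (r : ℝ) (p : ι → ℝ) (i : ι) : ℝ :=
  m.shoppers * m.cheapestShare p i + (1 - m.shoppers) * m.searcherShare r p i

/-- The expected profit of seller `i` when sellers randomize independently according to `σ`
(production costs are zero). -/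
def profit (m : StahlMarket ι) (r : ℝ) (σ : ι → Measure ℝ) (i : ι) : ℝ :=
  ∫ p, p i * m.quantity r p i ∂(Measure.pi σ)

/-- The profile `σ` is a profile of strategies, and no seller can gain by a unilateral deviation, given
that searchers search with reserve price `r`. Any equilibrium with reserve price `r` has these
properties, whatever is required in addition about the searchers' beliefs and the optimality of `r`;
no such further requirement is made here. -/
structure IsReservePriceEquilibrium (m : StahlMarket ι) (r : ℝ) (σ : ι → Measure ℝ) : Prop where
  reserve : m.IsReservePrice r
  strategy : ∀ i, m.IsStrategy (σ i)
  no_deviation : ∀ i, ∀ τ : Measure ℝ, m.IsStrategy τ →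
    m.profit r (Function.update σ i τ) i ≤ m.profit r σ i

/-- For an original market (one store per seller) with `n` sellers, the price `P` with
`P * (μ + (1 - μ) / n) = r * ((1 - μ) / n)`, where `μ` is the fraction of shoppers. -/
def lowestPrice (m : StahlMarket ι) (r : ℝ) : ℝ :=
  r * (1 - m.shoppers) / (((Fintype.card ι : ℝ) - 1) * m.shoppers + 1)

/-- The three-group form of the strategies in an original market: there is an atomless distribution
`ν` with support `[lowestPrice, r]` such that at least two sellers use `ν`, and every seller either
uses `ν`, or chooses `r` purely, or has a cutoff price `q`, using `ν` below `q` and choosing `r` with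
the remaining probability; all profits are equal to `r * (1 - μ) / n`. -/
def HasStahlForm (m : StahlMarket ι) (r : ℝ) (σ : ι → Measure ℝ) : Prop :=
  (∃ ν : Measure ℝ, IsProbabilityMeasure ν ∧ (∀ x, ν {x} = 0) ∧
    ν.support = Set.Icc (m.lowestPrice r) r ∧
    (∃ i j, i ≠ j ∧ σ i = ν ∧ σ j = ν) ∧
    ∀ i, σ i = ν ∨ σ i = Measure.dirac r ∨
      ∃ q ∈ Set.Ioo (m.lowestPrice r) r,
        σ i = ν.restrict (Set.Iio q) + ν (Set.Ici q) • Measure.dirac r) ∧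
  ∀ i, m.profit r σ i = r * (1 - m.shoppers) / (Fintype.card ι : ℝ)

/-- The original market played by the sellers with exactly `s` stores, each now counted as one store,
in which the buyers are all shoppers and those searchers of `m` whose first visit is to one of these
sellers, the total mass of buyers being normalized to one. -/
def submarket (m : StahlMarket ι) (s : ℕ) : StahlMarket {i // m.stores i = s} where
  shoppers := m.shoppers / (m.shoppers +
    (1 - m.shoppers) * ∑ i : {i // m.stores i = s}, (m.stores i.1 : ℝ) / m.totalStores)
  searchCost := m.searchCost
  maxPrice := m.maxPrice
  stores := fun _ => 1

end StahlMarket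

end

set_option linter.unusedSectionVars false

/-! Above the reserve price `r` searchers behave like shoppers (`quantity_of_lt`), so there is pure
Bertrand competition. A positive profit at such prices needs the tails of all rivals to be bounded
below there. For two sellers this forces their highest prices to be a common atom
(`exists_common_atom`), and undercutting this tie pays. So nobody charges more than `r`
(`measure_Ioi_eq_zero`).

Hence every searcher buys at the first store: a seller has captive buyers in proportion to its
stores and competes only for the shoppers (`IsPricingEquilibrium`, with the mass of shoppers scaled
to one). Call `π i - r * α i` the rent of `i`. Imitating the lowest price of another seller shows
that the rent is largest for the sellers with fewest captive buyers (`rent_le`), and the common atom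
argument shows that two sellers cannot both have positive rents (`not_both_rents_pos`). With two
smallest sellers all rents vanish, which makes profits proportional to store numbers. A larger
seller loses more captive revenue by a price cut; if the cut still paid for it, a smallest seller
would gain strictly from the same price. So larger sellers choose `r` (`eq_dirac_of_captive_lt`).

They then have tail one up to `r` and do not affect the others, who play a symmetric game. There, no
strategy has atoms below `r` (`atomless_below`), and a seller with mass left on `[p, r)` has the
smallest tail at `p` (`tail_le_of_active`). Two sellers stay active up to `r` and so share one
distribution `ν`; the others follow `ν` until they stop and move to `r` (`eq_cutoff`). Conversely,
such a pricing equilibrium is an equilibrium of the submarket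
(`isReservePriceEquilibrium_of_isPricingEquilibrium`). -/

noncomputable section

open Set Filter Topology

/-! ### Upper tails of probability distributions on the real line -/

/-- The probability of a price of at least `x`. -/
def tail (ν : Measure ℝ) (x : ℝ) : ℝ := ν.real (Ici x)

section Tail

variable {ν : Measure ℝ} [IsProbabilityMeasure ν]

lemma tail_nonneg (ν : Measure ℝ) (x : ℝ) : 0 ≤ tail ν x := measureReal_nonneg

lemma tail_le_one (x : ℝ) : tail ν x ≤ 1 := measureReal_le_one

lemma tail_antitone : Antitone (tail ν) := fun _ _ h => measureReal_mono (Ici_subset_Ici.2 h)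

lemma measureReal_Ico {x y : ℝ} (h : x ≤ y) : ν.real (Ico x y) = tail ν x - tail ν y := by
  rw [← Ici_sdiff_Ici, tail, tail, measureReal_sdiff (Ici_subset_Ici.2 h) measurableSet_Ici]

lemma measureReal_Iio (x : ℝ) : ν.real (Iio x) = 1 - tail ν x := by
  rw [← compl_Ici, probReal_compl_eq_one_sub measurableSet_Ici, tail]

lemma tail_eq_atom_add (x : ℝ) : tail ν x = ν.real {x} + ν.real (Ioi x) := by
  rw [tail, ← Ioi_insert, insert_eq, measureReal_union (by simp) measurableSet_Ioi]

lemma tail_tendsto_left (x : ℝ) : Tendsto (tail ν) (𝓝[<] x) (𝓝 (tail ν x)) := by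
  have h := tendsto_measure_biInter_gt (μ := ν) (s := fun t : ℝ => Ici (x - t)) (a := 0)
    (fun r _ => measurableSet_Ici.nullMeasurableSet)
    (fun i j _ hij => Ici_subset_Ici.2 (by linarith)) ⟨1, one_pos, measure_ne_top _ _⟩
  have hI : (⋂ t : ℝ, ⋂ (_ : t > 0), Ici (x - t)) = Ici x := by
    ext y
    simp only [mem_iInter, mem_Ici]
    refine ⟨fun h => le_of_forall_pos_le_add fun ε hε => by linarith [h ε hε],
      fun h t ht => by linarith⟩
  rw [hI] at h
  have h2 : Tendsto (fun y => x - y) (𝓝[<] x) (𝓝[>] 0) := by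
    refine tendsto_nhdsWithin_iff.2 ⟨?_, ?_⟩
    · have : Tendsto (fun y => x - y) (𝓝 x) (𝓝 (x - x)) := tendsto_id.const_sub x
      rw [sub_self] at this
      exact this.mono_left nhdsWithin_le_nhds
    · filter_upwards [self_mem_nhdsWithin] with y hy
      simpa using hy
  have h3 := (ENNReal.tendsto_toReal (measure_ne_top ν (Ici x))).comp (h.comp h2)
  refine h3.congr fun y => ?_
  simp [tail, Measure.real]


end Tail

/-- The tail is left-continuous, so that its superlevel sets contain their suprema. -/
lemma exists_max_level (ν : Measure ℝ) [IsProbabilityMeasure ν] {c x₀ x₁ : ℝ} (h₀ : c ≤ tail ν x₀)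
    (h₁ : tail ν x₁ < c) : ∃ v, x₀ ≤ v ∧ c ≤ tail ν v ∧ ∀ y > v, tail ν y < c := by
  set A := {x | c ≤ tail ν x}
  have hb : BddAbove A := ⟨x₁, fun x hx => by
    by_contra! h
    exact absurd (hx.trans (tail_antitone h.le)) (not_le.2 h₁)⟩
  refine ⟨sSup A, le_csSup hb h₀, ?_, fun y hy => ?_⟩
  · refine ge_of_tendsto (tail_tendsto_left (sSup A)) ?_
    filter_upwards [self_mem_nhdsWithin] with y hy
    obtain ⟨z, hz, hyz⟩ := exists_lt_of_lt_csSup ⟨x₀, h₀⟩ hy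
    exact le_trans hz (tail_antitone hyz.le)
  · by_contra! h
    exact absurd (le_csSup hb h) (not_le.2 hy)

/-- If each of two distributions charges only points at which the tail of the other one is bounded
below, they have a common atom. -/
lemma exists_common_atom {μ ν : Measure ℝ} [IsProbabilityMeasure μ] [IsProbabilityMeasure ν]
    {r R δ : ℝ} (hδ : 0 < δ) (hμR : μ (Ioi R) = 0) (hνR : ν (Ioi R) = 0)
    (hμ : ∀ᵐ p ∂μ, r < p → δ ≤ tail ν p) (hν : ∀ᵐ p ∂ν, r < p → δ ≤ tail μ p)
    (hpos : 0 < μ (Ioi r)) : ∃ v, r < v ∧ 0 < μ {v} ∧ 0 < ν {v} := by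
  -- The last point `v` at which the tail of `ν` is at least `δ` bounds the prices of `μ` from
  -- above. With the roles exchanged this gives a second point `w`; if they differed, one tail would
  -- vanish where it is at least `δ`. At the common point the whole tail is an atom.
  have key : ∀ {μ ν : Measure ℝ} [IsProbabilityMeasure μ] [IsProbabilityMeasure ν],
      ν (Ioi R) = 0 → (∀ᵐ p ∂μ, r < p → δ ≤ tail ν p) → 0 < μ (Ioi r) →
      ∃ v, r < v ∧ δ ≤ tail ν v ∧ μ (Ioi v) = 0 := by
    intro μ ν _ _ hR h hp
    obtain ⟨p, hp1, hp2⟩ : ∃ p, r < p ∧ δ ≤ tail ν p := by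
      by_contra! hcon
      refine hp.ne' (measure_mono_null (fun p hp => ?_) (ae_iff.1 h))
      simp only [mem_ofPred_eq, Classical.not_imp, not_le]
      exact ⟨hp, hcon p hp⟩
    have hR' : tail ν (R + 1) < δ := by
      have : ν (Ici (R + 1)) = 0 := measure_mono_null (fun x hx => by
        simp only [mem_Ici, mem_Ioi] at *; linarith) hR
      simpa [tail, Measure.real, this] using hδ
    obtain ⟨v, hv1, hv2, hv3⟩ := exists_max_level ν hp2 hR'
    refine ⟨v, hp1.trans_le hv1, hv2, measure_mono_null (fun x hx => ?_) (ae_iff.1 h)⟩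
    simp only [mem_ofPred_eq, Classical.not_imp, not_le]
    exact ⟨(hp1.trans_le hv1).trans hx, hv3 x hx⟩
  obtain ⟨v, hv1, hv2, hv3⟩ := key hνR hμ hpos
  have hνpos : 0 < ν (Ioi r) := by
    have : 0 < ν (Ici v) := by
      have := hδ.trans_le hv2
      exact (ENNReal.toReal_pos_iff.1 this).1
    exact this.trans_le (measure_mono fun x hx => hv1.trans_le hx)
  obtain ⟨w, hw1, hw2, hw3⟩ := key hμR hν hνpos
  have hvw : v = w := by
    rcases lt_trichotomy v w with h | h | h
    · have : tail μ w = 0 := by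
        simp [tail, Measure.real, measure_mono_null (fun x hx => h.trans_le hx : Ici w ⊆ Ioi v) hv3]
      linarith
    · exact h
    · have : tail ν v = 0 := by
        simp [tail, Measure.real, measure_mono_null (fun x hx => h.trans_le hx : Ici v ⊆ Ioi w) hw3]
      linarith
  subst hvw
  refine ⟨v, hv1, ?_, ?_⟩
  · have := tail_eq_atom_add (ν := μ) v
    rw [show μ.real (Ioi v) = 0 by simp [Measure.real, hv3], add_zero] at this
    exact (ENNReal.toReal_pos_iff.1 (this ▸ hδ.trans_le hw2 : 0 < μ.real {v})).1
  · have := tail_eq_atom_add (ν := ν) v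
    rw [show ν.real (Ioi v) = 0 by simp [Measure.real, hw3], add_zero] at this
    exact (ENNReal.toReal_pos_iff.1 (this ▸ hδ.trans_le hv2 : 0 < ν.real {v})).1

/-! ### Price competition with captive buyers -/

section Pricing

variable {ι : Type*} [Fintype ι] [DecidableEq ι]

/-- The probability that all sellers other than `i` charge at least `x`. -/
def rivalTail (σ : ι → Measure ℝ) (i : ι) (x : ℝ) : ℝ := ∏ j ∈ Finset.univ.erase i, tail (σ j) x

/-- Equilibrium conditions for the pricing game in which seller `i` has a mass `α i` of captive buyers
who accept all prices up to `r`, and the sellers compete for a unit mass of shoppers; `π i` is the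
equilibrium profit of `i`. -/
structure IsPricingEquilibrium (r : ℝ) (α π : ι → ℝ) (σ : ι → Measure ℝ) : Prop where
  prob : ∀ i, IsProbabilityMeasure (σ i)
  reserve_pos : 0 < r
  captive_pos : ∀ i, 0 < α i
  le_reserve : ∀ i, σ i (Ioi r) = 0
  -- `rivalTail` is built from closed half-lines and so counts ties as won: this is the limit of the
  -- profits from undercutting `x`.
  profit_le : ∀ i, ∀ x ≤ r, x * (rivalTail σ i x + α i) ≤ π i
  profit_eq : ∀ i, ∀ᵐ x ∂σ i, x * (rivalTail σ i x + α i) = π i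
  -- Two sellers may tie only where some third seller is almost surely cheaper, so that undercutting
  -- gains nothing.
  no_tie : ∀ i j x, i ≠ j → 0 < σ i {x} → 0 < σ j {x} →
    ∏ l ∈ (Finset.univ.erase i).erase j, tail (σ l) x = 0

lemma rivalTail_nonneg (σ : ι → Measure ℝ) (i : ι) (x : ℝ) : 0 ≤ rivalTail σ i x :=
  Finset.prod_nonneg fun _ _ => tail_nonneg _ _

lemma rivalTail_antitone {σ : ι → Measure ℝ} [∀ i, IsProbabilityMeasure (σ i)] (i : ι) :
    Antitone (rivalTail σ i) := fun _ _ h =>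
  Finset.prod_le_prod (fun _ _ => tail_nonneg _ _) fun _ _ => tail_antitone h

lemma rivalTail_tendsto_left {σ : ι → Measure ℝ} [∀ i, IsProbabilityMeasure (σ i)] (i : ι) (x : ℝ) :
    Tendsto (rivalTail σ i) (𝓝[<] x) (𝓝 (rivalTail σ i x)) :=
  tendsto_finsetProd _ fun _ _ => tail_tendsto_left x

lemma rivalTail_eq_mul (σ : ι → Measure ℝ) {i j : ι} (h : i ≠ j) (x : ℝ) :
    rivalTail σ i x = tail (σ j) x * ∏ l ∈ (Finset.univ.erase i).erase j, tail (σ l) x :=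
  (Finset.mul_prod_erase _ _ (Finset.mem_erase.2 ⟨h.symm, Finset.mem_univ j⟩)).symm

lemma prod_erase_erase_comm (f : ι → ℝ) (i j : ι) :
    ∏ l ∈ (Finset.univ.erase i).erase j, f l = ∏ l ∈ (Finset.univ.erase j).erase i, f l := by
  rw [Finset.erase_right_comm]

/-- A seller with the larger tail faces rivals with the smaller joint tail. -/
lemma rivalTail_le_of_tail_le (σ : ι → Measure ℝ) {i j : ι} {x : ℝ}
    (h : tail (σ j) x ≤ tail (σ i) x) : rivalTail σ i x ≤ rivalTail σ j x := by
  rcases eq_or_ne i j with rfl | hij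
  · rfl
  rw [rivalTail_eq_mul σ hij, rivalTail_eq_mul σ hij.symm, prod_erase_erase_comm _ i j]
  exact mul_le_mul_of_nonneg_right h (Finset.prod_nonneg fun _ _ => tail_nonneg _ _)

lemma rivalTail_le_tail {σ : ι → Measure ℝ} [∀ i, IsProbabilityMeasure (σ i)] {i j : ι}
    (h : i ≠ j) (x : ℝ) : rivalTail σ i x ≤ tail (σ j) x := by
  rw [rivalTail_eq_mul σ h]
  exact mul_le_of_le_one_right (tail_nonneg _ _)
    (Finset.prod_le_one (fun _ _ => tail_nonneg _ _) fun _ _ => tail_le_one _)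

lemma eq_dirac_of_tail {ν : Measure ℝ} [IsProbabilityMeasure ν] {r : ℝ} (h : ν (Ioi r) = 0)
    (h1 : 1 ≤ tail ν r) : ν = Measure.dirac r := by
  refine Measure.ext_of_Ici _ _ fun x => ?_
  rcases le_or_gt x r with hx | hx
  · have : 1 ≤ ν.real (Ici x) := h1.trans (tail_antitone hx)
    have h2 : ν.real (Ici x) = 1 := le_antisymm measureReal_le_one this
    rw [Measure.dirac_apply' _ measurableSet_Ici, indicator_of_mem (mem_Ici.2 hx)]
    exact (ENNReal.toReal_eq_one_iff _).1 h2
  · rw [Measure.dirac_apply' _ measurableSet_Ici, indicator_of_notMem (by simpa using hx),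
      measure_mono_null (fun y hy => hx.trans_le hy : Ici x ⊆ Ioi r) h]

namespace IsPricingEquilibrium

variable {r : ℝ} {α π : ι → ℝ} {σ : ι → Measure ℝ} (E : IsPricingEquilibrium r α π σ)
include E

lemma captive_profit_le (i : ι) : r * α i ≤ π i :=
  (mul_le_mul_of_nonneg_left (by linarith [rivalTail_nonneg σ i r]) E.reserve_pos.le).trans
    (E.profit_le i r le_rfl)

lemma profit_pos (i : ι) : 0 < π i :=
  (mul_pos E.reserve_pos (E.captive_pos i)).trans_le (E.captive_profit_le i)

lemma pos_of_eq {i : ι} {x : ℝ} (h : x * (rivalTail σ i x + α i) = π i) : 0 < x := by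
  by_contra! hx
  have := mul_nonneg (neg_nonneg.2 hx) (add_nonneg (rivalTail_nonneg σ i x) (E.captive_pos i).le)
  linarith [E.profit_pos i]

lemma ae_le_reserve (i : ι) : ∀ᵐ x ∂σ i, x ≤ r := by
  have := E.le_reserve i
  rw [ae_iff]
  simpa [Ioi] using this

lemma tail_eq_zero (i : ι) {x : ℝ} (h : r < x) : tail (σ i) x = 0 := by
  simp [tail, Measure.real,
    measure_mono_null (fun y hy => h.trans_le hy : Ici x ⊆ Ioi r) (E.le_reserve i)]

lemma tail_zero (i : ι) : tail (σ i) 0 = 1 := by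
  have := E.prob i
  have h : σ i (Iio 0) = 0 := by
    refine measure_mono_null (fun x hx => ?_) (ae_iff.1 (E.profit_eq i))
    intro h
    exact absurd (E.pos_of_eq h) (not_lt.2 (le_of_lt hx))
  have := measureReal_Iio (ν := σ i) 0
  simp only [Measure.real, h, ENNReal.toReal_zero] at this
  linarith

lemma exists_eq_of_tail_lt {i : ι} {x y : ℝ} (h : tail (σ i) y < tail (σ i) x) :
    ∃ p ∈ Ico x y, p ≤ r ∧ p * (rivalTail σ i p + α i) = π i := by
  have := E.prob i
  by_contra! hcon
  have hxy : x ≤ y := by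
    by_contra! h'
    exact absurd (tail_antitone (ν := σ i) h'.le) (not_le.2 h)
  have h0 : σ i (Ico x y) = 0 := by
    refine measure_mono_null (fun p hp => ?_)
      (ae_iff.1 ((E.profit_eq i).and (E.ae_le_reserve i)))
    exact fun h => hcon p hp h.2 h.1
  have := measureReal_Ico (ν := σ i) hxy
  simp only [Measure.real, h0, ENNReal.toReal_zero] at this
  linarith

lemma le_reserve_of_tail_lt {i : ι} {x y : ℝ} (h : tail (σ i) y < tail (σ i) x) : x ≤ r := by
  by_contra! hx
  rw [E.tail_eq_zero i hx] at h
  exact absurd (tail_nonneg _ _) (not_le.2 h)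

/-- A seller attains its profit at every point to the right of which it puts mass. -/
lemma eq_of_right_mass {i : ι} {x : ℝ} (h : ∀ y > x, tail (σ i) y < tail (σ i) x) :
    x * (rivalTail σ i x + α i) = π i := by
  have := E.prob
  refine le_antisymm (E.profit_le i x (E.le_reserve_of_tail_lt (h (x + 1) (by linarith)))) ?_
  have hy : ∀ y > x, π i ≤ y * (rivalTail σ i x + α i) := fun y hy => by
    obtain ⟨p, hp, -, hpe⟩ := E.exists_eq_of_tail_lt (h y hy)
    have hp0 := E.pos_of_eq hpe
    rw [← hpe]
    have h1 := rivalTail_antitone (σ := σ) i hp.1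
    exact mul_le_mul hp.2.le (by linarith)
      (add_nonneg (rivalTail_nonneg _ _ _) (E.captive_pos i).le) (hp0.le.trans hp.2.le)
  have ht : Tendsto (fun y => y * (rivalTail σ i x + α i)) (𝓝[>] x)
      (𝓝 (x * (rivalTail σ i x + α i))) :=
    (tendsto_id.mul_const _).mono_left nhdsWithin_le_nhds
  refine ge_of_tendsto ht ?_
  filter_upwards [self_mem_nhdsWithin] with y h using hy y h

/-- A seller attains its profit at every point to the left of which it puts mass. -/
lemma eq_of_left_mass {i : ι} {x : ℝ} (h : ∀ y < x, tail (σ i) x < tail (σ i) y) :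
    x * (rivalTail σ i x + α i) = π i := by
  have := E.prob
  have ht : Tendsto (fun y => y * (rivalTail σ i y + α i)) (𝓝[<] x)
      (𝓝 (x * (rivalTail σ i x + α i))) :=
    (tendsto_id.mono_left nhdsWithin_le_nhds).mul ((rivalTail_tendsto_left i x).add_const _)
  refine mem_singleton_iff.1
    ((isClosed_singleton (x := π i)).mem_of_frequently_of_tendsto ?_ ht)
  rw [frequently_iff]
  intro U hU
  obtain ⟨y, hy, hU⟩ := (mem_nhdsLT_iff_exists_Ioo_subset).1 hU
  obtain ⟨p, hp, -, hpe⟩ := E.exists_eq_of_tail_lt (h ((x + y) / 2) (by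
    have : y < x := hy
    linarith))
  refine ⟨p, hU ⟨?_, hp.2⟩, hpe⟩
  have h1 : y < x := hy
  linarith [hp.1]

lemma eq_of_atom {i : ι} {x : ℝ} (h : 0 < σ i {x}) : x * (rivalTail σ i x + α i) = π i := by
  by_contra hne
  exact h.ne' (measure_mono_null (by simpa using hne) (ae_iff.1 (E.profit_eq i)))

/-- The infimum of the prices charged by a seller. -/
lemma exists_lowest (i : ι) : ∃ x ≤ r, tail (σ i) x = 1 ∧ (∀ y > x, tail (σ i) y < 1) ∧
    x * (rivalTail σ i x + α i) = π i := by
  have := E.prob i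
  obtain ⟨x, -, hx, hx'⟩ := exists_max_level (σ i) (E.tail_zero i).ge (x₁ := r + 1) (by
    rw [E.tail_eq_zero i (by linarith)]; exact one_pos)
  have hx1 := le_antisymm (tail_le_one x) hx
  have h : ∀ y > x, tail (σ i) y < tail (σ i) x := fun y hy => by rw [hx1]; exact hx' y hy
  exact ⟨x, E.le_reserve_of_tail_lt (h (x + 1) (by linarith)), hx1, hx', E.eq_of_right_mass h⟩

/-- The rents over the captive profit are highest for the sellers with the fewest captive buyers. -/
lemma rent_le {z l : ι} (h : α l ≤ α z) : π z - r * α z ≤ π l - r * α l := by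
  have := E.prob
  obtain ⟨x, hxr, hx1, -, hxe⟩ := E.exists_lowest z
  -- At its lowest price `x`, seller `z` has tail one, so `l` faces at least as large a joint tail
  -- there. The rent of `z` is `x * rivalTail σ z x - (r - x) * α z`, and the same expression for
  -- `l` is larger and bounded by the rent of `l`.
  have h1 := rivalTail_le_of_tail_le σ (i := z) (j := l) (x := x) (by
    rw [hx1]; exact tail_le_one x)
  have h2 := E.profit_le l x hxr
  have h3 := E.pos_of_eq hxe
  nlinarith

/-- A positive rent must come from shoppers, so every price of `a` meets a tail of `b` of at least
the rent divided by `r`, and vice versa. Hence there is a common atom `v`; by `no_tie` no shoppers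
are won there, which leaves at most the captive profit. -/
lemma not_both_rents_pos {a b : ι} (hab : a ≠ b) (ha : r * α a < π a) (hb : r * α b < π b) :
    False := by
  have := E.prob
  have key : ∀ {a b : ι}, a ≠ b → ∀ᵐ p ∂σ a, 0 < p → (π a - r * α a) / r ≤ tail (σ b) p := by
    intro a b hab
    filter_upwards [E.profit_eq a, E.ae_le_reserve a] with p h1 h2 h3
    rw [div_le_iff₀ E.reserve_pos]
    have h4 := rivalTail_le_tail (σ := σ) hab p
    have h5 := rivalTail_nonneg σ a p
    have h6 := E.captive_pos a
    nlinarith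
  have hr := E.reserve_pos
  obtain ⟨v, -, hv1, hv2⟩ := exists_common_atom (μ := σ a) (ν := σ b) (r := 0) (R := r)
    (δ := min ((π a - r * α a) / r) ((π b - r * α b) / r))
    (lt_min (div_pos (by linarith) hr) (div_pos (by linarith) hr)) (E.le_reserve a)
    (E.le_reserve b) (by filter_upwards [key hab] with p h hp using (min_le_left _ _).trans (h hp))
    (by filter_upwards [key hab.symm] with p h hp using (min_le_right _ _).trans (h hp)) (by
      rw [pos_iff_ne_zero]
      intro h0
      have h1 : ∀ᵐ p ∂σ a, False := by
        have h0' : ∀ᵐ p ∂σ a, p ≤ 0 := by rw [ae_iff]; simpa [Ioi] using h0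
        filter_upwards [E.profit_eq a, h0'] with p h h'
        exact absurd (E.pos_of_eq h) (not_lt.2 h')
      obtain ⟨_, h⟩ := h1.exists
      exact h)
  have h1 := E.eq_of_atom hv1
  have h2 := E.no_tie a b v hab hv1 hv2
  rw [rivalTail_eq_mul σ hab, h2, mul_zero, zero_add] at h1
  have h3 : v ≤ r := by
    by_contra! h
    exact hv1.ne' (measure_mono_null (by simpa using h) (E.le_reserve a))
  have := mul_le_mul_of_nonneg_right h3 (E.captive_pos a).le
  linarith

/-- With two sellers with the fewest captive buyers, all sellers only earn the captive profit. -/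
theorem profit_eq_captive {a b : ι} (hab : a ≠ b) (ha : ∀ i, α a ≤ α i) (hb : ∀ i, α b ≤ α i)
    (i : ι) : π i = r * α i := by
  refine le_antisymm ?_ (E.captive_profit_le i)
  by_contra! h
  have h1 := E.rent_le (ha i)
  have h2 := E.rent_le (hb i)
  exact E.not_both_rents_pos hab (by linarith) (by linarith)

/-- A seller who has more captive buyers than another one chooses the reserve price. -/
theorem eq_dirac_of_captive_lt (hπ : ∀ i, π i = r * α i) {i a : ι} (h : α a < α i) :
    σ i = Measure.dirac r := by
  have := E.prob
  obtain ⟨x, hxr, hx1, hx2, hxe⟩ := E.exists_lowest i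
  rcases hxr.eq_or_lt with rfl | hlt
  · exact eq_dirac_of_tail (E.le_reserve i) hx1.ge
  exfalso
  -- Zero rents give `x * rivalTail σ i x = (r - x) * α i` and `x * rivalTail σ a x ≤ (r - x) * α
  -- a`; as `x < r`, this contradicts the order of the joint tails.
  have h1 := rivalTail_le_of_tail_le σ (i := i) (j := a) (x := x) (by
    rw [hx1]; exact tail_le_one x)
  have h2 := E.profit_le a x hxr
  have h3 := E.pos_of_eq hxe
  rw [hπ] at h2 hxe
  nlinarith

end IsPricingEquilibrium

end Pricing

/-- Reflection of `exists_max_level`: open tails are right-continuous, so their sublevel sets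
contain their infima. -/
lemma exists_min_level (ν : Measure ℝ) [IsProbabilityMeasure ν] {c x₀ x₁ : ℝ}
    (h₀ : c < ν.real (Ioi x₀)) (h₁ : ν.real (Ioi x₁) ≤ c) :
    ∃ v ≤ x₁, ν.real (Ioi v) ≤ c ∧ ∀ y < v, c < ν.real (Ioi y) := by
  have := Measure.isProbabilityMeasure_map (μ := ν) (f := fun x : ℝ => -x) (by fun_prop)
  have ht : ∀ x, tail (ν.map fun x : ℝ => -x) x = 1 - ν.real (Ioi (-x)) := fun x => by
    rw [tail, map_measureReal_apply (by fun_prop) measurableSet_Ici,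
      ← probReal_compl_eq_one_sub measurableSet_Ioi]
    congr 1
    ext y
    simp
  obtain ⟨v, h1, h2, h3⟩ := exists_max_level (ν.map fun x : ℝ => -x) (c := 1 - c) (x₀ := -x₁)
    (x₁ := -x₀) (by rw [ht, neg_neg]; linarith) (by rw [ht, neg_neg]; linarith)
  rw [ht] at h2
  refine ⟨-v, by linarith, by linarith, fun y hy => ?_⟩
  have := h3 (-y) (by linarith)
  rw [ht, neg_neg] at this
  linarith

lemma measure_Ici_eq_of_tail {μ ν : Measure ℝ} [IsProbabilityMeasure μ] [IsProbabilityMeasure ν]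
    {x y : ℝ} (h : tail μ x = tail ν y) : μ (Ici x) = ν (Ici y) :=
  (ENNReal.toReal_eq_toReal_iff' (measure_ne_top _ _) (measure_ne_top _ _)).1 h

lemma ext_of_tail {μ ν : Measure ℝ} [IsProbabilityMeasure μ] [IsProbabilityMeasure ν]
    (h : ∀ x, tail μ x = tail ν x) : μ = ν :=
  Measure.ext_of_Ici _ _ fun x => measure_Ici_eq_of_tail (h x)

lemma tail_eq_Ioi {ν : Measure ℝ} [IsProbabilityMeasure ν] {x : ℝ} (h : ν {x} = 0) :
    tail ν x = ν.real (Ioi x) := by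
  rw [tail_eq_atom_add, Measure.real, h, ENNReal.toReal_zero, zero_add]

/-! ### The symmetric pricing game with zero rents -/

namespace IsPricingEquilibrium

variable {ι : Type*} [Fintype ι] [DecidableEq ι] {r c : ℝ} {σ : ι → Measure ℝ}
  (E : IsPricingEquilibrium r (fun _ => c) (fun _ => r * c) σ)
include E

lemma rivalTail_pos_of_eq {i : ι} {x : ℝ} (hx : x < r) (h : x * (rivalTail σ i x + c) = r * c) :
    0 < rivalTail σ i x := by
  have h0 := E.pos_of_eq h
  have hc := E.captive_pos i
  by_contra! hn
  nlinarith

lemma rivalTail_reserve_eq_zero (i : ι) : rivalTail σ i r = 0 := by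
  have h := E.profit_le i r le_rfl
  have hr := E.reserve_pos
  have := rivalTail_nonneg σ i r
  nlinarith

/-- At `r * c / (1 + c)` even winning all shoppers earns just `r * c`, so nobody charges less. -/
lemma tail_lowest (i : ι) : tail (σ i) (r * c / (1 + c)) = 1 := by
  have := E.prob
  have hc := E.captive_pos i
  obtain ⟨x, -, hx1, -, hxe⟩ := E.exists_lowest i
  refine le_antisymm (tail_le_one _) (hx1 ▸ tail_antitone ?_)
  rw [div_le_iff₀ (by linarith), ← hxe]
  have h1 : rivalTail σ i x ≤ 1 :=
    Finset.prod_le_one (fun _ _ => tail_nonneg _ _) fun _ _ => tail_le_one _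
  exact mul_le_mul_of_nonneg_left (by linarith) (E.pos_of_eq hxe).le

/-- A seller whose tail exceeds that of another one at `p` puts all remaining mass on the reserve
price. -/
lemma tail_reserve_eq_of_lt {a b : ι} {p : ℝ} (hp : p < r) (h : tail (σ b) p < tail (σ a) p) :
    tail (σ a) r = tail (σ a) p := by
  have := E.prob
  refine le_antisymm (tail_antitone hp.le) ?_
  -- `v` ends the interval after `p` on which the tail of `a` is constant. If `v < r`, then `a`
  -- attains its profit at `v`, where `b` faces a larger joint tail and would earn strictly more.
  obtain ⟨v, hv1, hv2, hv3⟩ := exists_max_level (σ a) (le_refl (tail (σ a) p)) (x₁ := r + 1) (by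
    rw [E.tail_eq_zero a (by linarith)]; exact (tail_nonneg _ _).trans_lt h)
  rcases le_or_gt r v with hrv | hvr
  · exact hv2.trans (tail_antitone hrv)
  exfalso
  have he := E.eq_of_right_mass fun y hy => (hv3 y hy).trans_le hv2
  have hpos := E.rivalTail_pos_of_eq hvr he
  have hab : a ≠ b := by rintro rfl; exact lt_irrefl _ h
  have hlt : tail (σ b) v < tail (σ a) v := (tail_antitone hv1).trans_lt (h.trans_le hv2)
  have h2 := E.profit_le b v hvr.le
  have h3 := E.pos_of_eq he
  rw [rivalTail_eq_mul σ hab] at hpos he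
  rw [rivalTail_eq_mul σ hab.symm, prod_erase_erase_comm] at h2
  have hQ := pos_of_mul_pos_right hpos (tail_nonneg _ _)
  have := mul_lt_mul_of_pos_right hlt hQ
  nlinarith

/-- Suppose `a` has an atom at `p`. Some rival `b` puts mass immediately to the right of `p`, since
otherwise `a` could raise its price without losing shoppers. By `no_tie` this mass lies strictly
above `p`, where `b` loses to the atom; prices just below `p` would be better for `b` by a fixed
amount. -/
lemma atomless_below (a : ι) {p : ℝ} (hp : p < r) : σ a {p} = 0 := by
  have := E.prob
  by_contra hne
  have hat : 0 < σ a {p} := pos_iff_ne_zero.2 hne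
  have he := E.eq_of_atom hat
  have hpos := E.rivalTail_pos_of_eq hp he
  have hp0 := E.pos_of_eq he
  obtain ⟨b, hab, hb⟩ : ∃ b, a ≠ b ∧ ∀ y > p, tail (σ b) y < tail (σ b) p := by
    by_contra! hcon
    have h1 : ∀ b, ∀ᶠ y in 𝓝[>] p, a ≠ b → tail (σ b) p ≤ tail (σ b) y := fun b => by
      by_cases hab : a = b
      · simp [hab]
      obtain ⟨y, hy, hy'⟩ := hcon b hab
      filter_upwards [Ioo_mem_nhdsGT hy] with z hz _ using hy'.trans (tail_antitone hz.2.le)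
    obtain ⟨y, hy1, hy2⟩ := ((eventually_all.2 h1).and (Ioo_mem_nhdsGT hp)).exists
    have h3 : rivalTail σ a p ≤ rivalTail σ a y :=
      Finset.prod_le_prod (fun _ _ => tail_nonneg _ _)
        fun j hj => hy1 j (Finset.ne_of_mem_erase hj).symm
    have h4 := E.profit_le a y hy2.2.le
    have h5 := hy2.1
    have hc := E.captive_pos a
    have h6 := mul_lt_mul_of_pos_right h5 (add_pos hpos hc)
    have h7 := mul_le_mul_of_nonneg_left h3 (hp0.trans h5).le
    linarith [mul_add y (rivalTail σ a p) c, mul_add y (rivalTail σ a y) c]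
  set Q := ∏ l ∈ (Finset.univ.erase a).erase b, tail (σ l) p with hQ
  have heb := E.eq_of_right_mass hb
  rw [rivalTail_eq_mul σ hab, ← hQ] at he hpos
  rw [rivalTail_eq_mul σ hab.symm, prod_erase_erase_comm, ← hQ] at heb
  have hQpos := pos_of_mul_pos_right hpos (tail_nonneg _ _)
  have hbat : σ b {p} = 0 := by
    by_contra hbat
    exact hQpos.ne' (E.no_tie a b p hab hat (pos_iff_ne_zero.2 hbat))
  -- Prices of `b` beyond `p` meet only the open tail of `a`. In the limit `y → p` this contradicts
  -- `heb`, in which the atom is included.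
  have hy : ∀ y > p, r * c ≤ y * ((σ a).real (Ioi p) * Q + c) := fun y hy => by
    obtain ⟨q, hq, hqe⟩ : ∃ q ∈ Ioo p y, q * (rivalTail σ b q + c) = r * c := by
      by_contra! hcon
      have h0 : σ b (Ico p y) = 0 := by
        rw [← Ioo_insert_left hy, insert_eq]
        refine measure_union_null hbat (measure_mono_null (fun q hq => ?_)
          (ae_iff.1 (E.profit_eq b)))
        exact hcon q hq
      have h1 := measureReal_Ico (ν := σ b) (le_of_lt hy)
      simp only [Measure.real, h0, ENNReal.toReal_zero] at h1
      linarith [hb y hy]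
    have hq0 := hp0.trans hq.1
    have h1 : rivalTail σ b q ≤ (σ a).real (Ioi p) * Q := by
      rw [rivalTail_eq_mul σ hab.symm, prod_erase_erase_comm]
      refine mul_le_mul (measureReal_mono fun x hx => hq.1.trans_le hx) ?_
        (Finset.prod_nonneg fun _ _ => tail_nonneg _ _) measureReal_nonneg
      exact Finset.prod_le_prod (fun _ _ => tail_nonneg _ _) fun _ _ => tail_antitone hq.1.le
    rw [← hqe]
    exact mul_le_mul hq.2.le (by linarith)
      (add_nonneg (rivalTail_nonneg _ _ _) (E.captive_pos a).le) (hq0.trans hq.2).le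
  have hlim : r * c ≤ p * ((σ a).real (Ioi p) * Q + c) := by
    have ht : Tendsto (fun y => y * ((σ a).real (Ioi p) * Q + c)) (𝓝[>] p)
        (𝓝 (p * ((σ a).real (Ioi p) * Q + c))) :=
      (tendsto_id.mul_const _).mono_left nhdsWithin_le_nhds
    refine ge_of_tendsto ht ?_
    filter_upwards [self_mem_nhdsWithin] with y h using hy y h
  have hatr : 0 < (σ a).real {p} := ENNReal.toReal_pos hne (measure_ne_top _ _)
  have h6 := tail_eq_atom_add (ν := σ a) p
  rw [h6] at heb
  have := mul_pos hp0 (mul_pos hatr hQpos)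
  nlinarith

lemma exists_min_level_below (a : ι) {t x₀ x₁ : ℝ} (h₀ : t < tail (σ a) x₀)
    (h₁ : tail (σ a) x₁ ≤ t) (hx : x₁ < r) :
    ∃ v ≤ x₁, tail (σ a) v ≤ t ∧ ∀ y < v, t < tail (σ a) y := by
  have := E.prob
  have h01 : x₀ < x₁ := by
    by_contra! h
    exact absurd (tail_antitone h) (not_le.2 (h₁.trans_lt h₀))
  obtain ⟨v, hv, hv1, hv2⟩ := exists_min_level (σ a) (c := t) (x₀ := x₀) (x₁ := x₁)
    (by rwa [← tail_eq_Ioi (E.atomless_below a (h01.trans hx))])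
    (by rwa [← tail_eq_Ioi (E.atomless_below a hx)])
  refine ⟨v, hv, by rwa [tail_eq_Ioi (E.atomless_below a (hv.trans_lt hx))], fun y hy => ?_⟩
  rw [tail_eq_Ioi (E.atomless_below a (hy.trans (hv.trans_lt hx)))]
  exact hv2 y hy

/-- Let `v` be the point where the tail of `j` reaches zero. The rivals have larger tails there, so
all their remaining mass is at `r`; then `j` would meet the same positive joint tail at `r`, where
it must vanish. -/
lemma tail_pos (j : ι) {p : ℝ} (hp : p < r) : 0 < tail (σ j) p := by
  have := E.prob
  by_contra! h
  obtain ⟨v, hvp, hv1, hv2⟩ := E.exists_min_level_below j (t := 0) (x₀ := 0)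
    (by rw [E.tail_zero]; exact one_pos) h hp
  have hv0 : tail (σ j) v = 0 := le_antisymm hv1 (tail_nonneg _ _)
  have hvr := hvp.trans_lt hp
  have he := E.eq_of_left_mass fun y hy => by rw [hv0]; exact hv2 y hy
  have hpos := E.rivalTail_pos_of_eq hvr he
  have : rivalTail σ j r = rivalTail σ j v := by
    refine Finset.prod_congr rfl fun l hl => E.tail_reserve_eq_of_lt hvr (b := j) ?_
    rw [hv0]
    refine (tail_nonneg _ _).lt_of_ne' fun h0 => hpos.ne' (Finset.prod_eq_zero hl h0)
  rw [E.rivalTail_reserve_eq_zero] at this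
  exact hpos.ne this

lemma rivalTail_pos (j : ι) {p : ℝ} (hp : p < r) : 0 < rivalTail σ j p :=
  Finset.prod_pos fun l _ => E.tail_pos l hp

/-- A seller who puts mass on `[p, r)` has the smallest tail at `p`. -/
lemma tail_le_of_active {a : ι} {p : ℝ} (hp : p < r) (h : tail (σ a) r < tail (σ a) p) (j : ι) :
    tail (σ a) p ≤ tail (σ j) p := by
  by_contra! hlt
  exact h.ne (E.tail_reserve_eq_of_lt hp hlt)

/-- If at most one seller `a` had mass on `[p, r)`, the joint tail facing `a` would be the same at
`p` and at `r`, but it is positive at `p` and zero at `r`. -/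
lemma exists_two_active [Nonempty ι] {p : ℝ} (hp : p < r) :
    ∃ a b, a ≠ b ∧ tail (σ a) r < tail (σ a) p ∧ tail (σ b) r < tail (σ b) p := by
  have := E.prob
  by_contra! h
  obtain ⟨a, ha⟩ : ∃ a, ∀ j, a ≠ j → tail (σ j) p ≤ tail (σ j) r := by
    by_cases h1 : ∃ a, tail (σ a) r < tail (σ a) p
    · obtain ⟨a, ha⟩ := h1
      exact ⟨a, fun j hj => h a j hj ha⟩
    · push Not at h1
      exact ⟨Classical.arbitrary ι, fun j _ => h1 j⟩
  have h1 : rivalTail σ a p ≤ rivalTail σ a r :=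
    Finset.prod_le_prod (fun _ _ => tail_nonneg _ _)
      fun j hj => ha j (Finset.ne_of_mem_erase hj).symm
  rw [E.rivalTail_reserve_eq_zero] at h1
  exact absurd h1 (not_le.2 (E.rivalTail_pos a hp))

/-- There are finitely many pairs, so one is active at points arbitrarily close to `r`; activity at
a point passes to all smaller points. -/
lemma exists_two_always_active [Nonempty ι] : ∃ a b, a ≠ b ∧
    (∀ p < r, tail (σ a) r < tail (σ a) p) ∧ ∀ p < r, tail (σ b) r < tail (σ b) p := by
  have := E.prob
  by_contra! h
  have h1 : ∀ a b, ∀ᶠ p in 𝓝[<] r,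
      ¬ (a ≠ b ∧ tail (σ a) r < tail (σ a) p ∧ tail (σ b) r < tail (σ b) p) := by
    intro a b
    by_contra hf
    rw [← Filter.Frequently] at hf
    obtain ⟨p, hp⟩ := hf.exists
    have key : ∀ y < r, tail (σ a) r < tail (σ a) y ∧ tail (σ b) r < tail (σ b) y := by
      intro y hy
      obtain ⟨q, hq, hq'⟩ := (hf.and_eventually (Ioo_mem_nhdsLT hy)).exists
      exact ⟨hq.2.1.trans_le (tail_antitone hq'.1.le), hq.2.2.trans_le (tail_antitone hq'.1.le)⟩
    obtain ⟨y, hy, hy'⟩ := h a b hp.1 fun y hy => (key y hy).1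
    exact absurd (key y hy).2 (not_lt.2 hy')
  obtain ⟨p, hp, hpr⟩ := ((eventually_all.2 fun a => eventually_all.2 (h1 a)).and
    self_mem_nhdsWithin).exists
  obtain ⟨a, b, hab⟩ := E.exists_two_active hpr
  exact hp a b hab

lemma tail_le_of_always_active {a : ι} (ha : ∀ p < r, tail (σ a) r < tail (σ a) p) (j : ι) {p : ℝ}
    (hp : p ≤ r) : tail (σ a) p ≤ tail (σ j) p := by
  have := E.prob
  rcases hp.lt_or_eq with hp | rfl
  · exact E.tail_le_of_active hp (ha p hp) j
  refine le_of_tendsto_of_tendsto (tail_tendsto_left p) (tail_tendsto_left p) ?_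
  filter_upwards [self_mem_nhdsWithin] with y hy using E.tail_le_of_active hy (ha y hy) j

lemma eq_of_always_active {a b : ι} (ha : ∀ p < r, tail (σ a) r < tail (σ a) p)
    (hb : ∀ p < r, tail (σ b) r < tail (σ b) p) : σ b = σ a := by
  have := E.prob
  refine ext_of_tail fun x => ?_
  rcases le_or_gt x r with hx | hx
  · exact le_antisymm (E.tail_le_of_always_active hb a hx) (E.tail_le_of_always_active ha b hx)
  · rw [E.tail_eq_zero _ hx, E.tail_eq_zero _ hx]

/-- The tail of `a` is the smallest one at `r`, and the joint tail there is zero. -/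
lemma tail_reserve_eq_zero {a : ι} (ha : ∀ p < r, tail (σ a) r < tail (σ a) p) :
    tail (σ a) r = 0 := by
  by_contra hne
  have hpos := (tail_nonneg (σ a) r).lt_of_ne' hne
  have h : 0 < rivalTail σ a r := Finset.prod_pos fun j _ =>
    hpos.trans_le (E.tail_le_of_always_active ha j le_rfl)
  exact h.ne' (E.rivalTail_reserve_eq_zero a)

lemma atomless {a : ι} (ha : ∀ p < r, tail (σ a) r < tail (σ a) p) (x : ℝ) : σ a {x} = 0 := by
  have := E.prob
  rcases lt_trichotomy x r with hx | rfl | hx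
  · exact E.atomless_below a hx
  · have h := E.tail_reserve_eq_zero ha
    have h' : σ a (Ici x) = 0 := by
      simpa [tail, Measure.real, ENNReal.toReal_eq_zero_iff] using h
    exact measure_mono_null (by simp) h'
  · exact measure_mono_null (by simpa using hx) (E.le_reserve a)

/-- There are no gaps: where the tail of `a` is constant, no rival can have mass, as it would then
drop below the smallest tail. So `a` could raise its price from the start of the gap to its end and
still meet the same joint tail. -/
lemma tail_strictAnti {a : ι} (ha : ∀ p < r, tail (σ a) r < tail (σ a) p) {p p' : ℝ}
    (hp : r * c / (1 + c) ≤ p) (hpp : p < p') (hp' : p' ≤ r) : tail (σ a) p' < tail (σ a) p := by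
  have := E.prob
  have hc : 0 < c := E.captive_pos a
  rcases hp'.eq_or_lt with rfl | hp'
  · exact ha p hpp
  refine (tail_antitone hpp.le).lt_of_ne fun hne => ?_
  -- If all tails were one at `p'`, charging `p'` would win all shoppers at more than the lowest
  -- profitable price.
  have h1 : tail (σ a) p' < 1 := by
    by_contra! h
    have hR : rivalTail σ a p' = 1 := Finset.prod_eq_one fun j _ =>
      le_antisymm (tail_le_one _) (h.trans (E.tail_le_of_always_active ha j hp'.le))
    have h2 := E.profit_le a p' hp'.le
    rw [hR] at h2
    rw [div_le_iff₀ (by linarith)] at hp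
    nlinarith
  obtain ⟨v, hv, hv1, hv2⟩ := E.exists_min_level_below a (t := tail (σ a) p')
    (x₀ := r * c / (1 + c)) (x₁ := p) (by rwa [E.tail_lowest]) hne.ge (hpp.trans hp')
  have hvp' := hv.trans_lt hpp
  have he := E.eq_of_left_mass fun y hy => hv1.trans_lt (hv2 y hy)
  have hR : rivalTail σ a v = rivalTail σ a p' := by
    refine Finset.prod_congr rfl fun j _ => le_antisymm ?_ (tail_antitone hvp'.le)
    by_contra! hlt
    have h3 := E.tail_le_of_active (hvp'.trans hp') ((tail_antitone hp'.le).trans_lt hlt) a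
    have h4 := E.tail_le_of_always_active ha j hp'.le
    linarith
  have h2 := E.profit_le a p' hp'.le
  have h5 := rivalTail_nonneg σ a p'
  rw [hR] at he
  nlinarith

lemma support_eq {a : ι} (ha : ∀ p < r, tail (σ a) r < tail (σ a) p) :
    (σ a).support = Icc (r * c / (1 + c)) r := by
  have := E.prob
  have hc : 0 < c := E.captive_pos a
  have hr := E.reserve_pos
  have hL : r * c / (1 + c) < r := by
    rw [div_lt_iff₀ (by linarith)]
    nlinarith
  refine Subset.antisymm (Measure.support_subset_of_isClosed isClosed_Icc ?_) fun x hx => ?_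
  · rw [mem_ae_iff]
    have h1 : σ a (Iio (r * c / (1 + c))) = 0 := by
      have h := measureReal_Iio (ν := σ a) (r * c / (1 + c))
      rw [E.tail_lowest, sub_self] at h
      simpa [Measure.real, ENNReal.toReal_eq_zero_iff] using h
    refine measure_mono_null (fun x hx => ?_) (measure_union_null h1 (E.le_reserve a))
    by_contra h
    simp only [mem_union, mem_Iio, mem_Ioi, not_or, not_lt] at h
    exact hx ⟨h.1, h.2⟩
  · rw [Measure.mem_support_iff_forall]
    intro U hU
    have key : ∀ p p', r * c / (1 + c) ≤ p → p < p' → p' ≤ r → Ico p p' ⊆ U → 0 < σ a U := by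
      intro p p' h1 h2 h3 h4
      have h5 := measureReal_Ico (ν := σ a) h2.le
      have h6 := E.tail_strictAnti ha h1 h2 h3
      have h7 : 0 < (σ a).real (Ico p p') := by linarith
      exact (ENNReal.toReal_pos_iff.1 h7).1.trans_le (measure_mono h4)
    rcases hx.2.lt_or_eq with hxr | rfl
    · obtain ⟨u, hu, hU'⟩ := exists_Ico_subset_of_mem_nhds hU ⟨r, hxr⟩
      exact key x (min u r) hx.1 (lt_min hu hxr) (min_le_right _ _)
        ((Ico_subset_Ico_right (min_le_left _ _)).trans hU')
    · obtain ⟨u, hu, hU'⟩ := exists_Ioc_subset_of_mem_nhds hU ⟨_, hL⟩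
      refine key ((max u (x * c / (1 + c)) + x) / 2) x ?_ ?_ le_rfl fun y hy => hU' ⟨?_, hy.2.le⟩
      · have := le_max_right u (x * c / (1 + c)); linarith
      · have := max_lt hu hL; linarith
      · have := le_max_left u (x * c / (1 + c)); have := max_lt hu hL; linarith [hy.1]

/-- Below `q` both `a` and `j` are active and so both have the smallest tail; left continuity
extends this to `q`, and between `q` and `r` the tail of `j` is constant. -/
lemma eq_cutoff {a j : ι} (ha : ∀ p < r, tail (σ a) r < tail (σ a) p) {q : ℝ} (hq : q < r)
    (hq1 : tail (σ j) q ≤ tail (σ j) r) (hq2 : ∀ y < q, tail (σ j) r < tail (σ j) y) :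
    σ j = (σ a).restrict (Iio q) + σ a (Ici q) • Measure.dirac r := by
  have := E.prob
  have hlt : ∀ y < q, tail (σ j) y = tail (σ a) y := fun y hy =>
    le_antisymm (E.tail_le_of_active (hy.trans hq) (hq2 y hy) a)
      (E.tail_le_of_always_active ha j (hy.trans hq).le)
  have hle : ∀ y ≤ q, σ j (Ici y) = σ a (Ici y) := fun y hy => by
    refine measure_Ici_eq_of_tail ?_
    rcases hy.lt_or_eq with hy | rfl
    · exact hlt y hy
    refine tendsto_nhds_unique_of_eventuallyEq (tail_tendsto_left y) (tail_tendsto_left y) ?_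
    filter_upwards [self_mem_nhdsWithin] with z hz using hlt z hz
  refine Measure.ext_of_Ici _ _ fun x => ?_
  rw [Measure.add_apply, Measure.smul_apply, Measure.restrict_apply measurableSet_Ici,
    Measure.dirac_apply' _ measurableSet_Ici, Ici_inter_Iio, smul_eq_mul]
  rcases le_or_gt x q with hx | hx
  · rw [indicator_of_mem (mem_Ici.2 (hx.trans hq.le)), Pi.one_apply, mul_one, hle x hx,
      ← Ico_union_Ici_eq_Ici hx, measure_union _ measurableSet_Ici]
    exact disjoint_left.2 fun y hy hy' => absurd hy.2 (not_lt.2 hy')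
  rw [Ico_eq_empty (not_lt.2 hx.le), measure_empty, zero_add]
  rcases le_or_gt x r with hxr | hxr
  · rw [indicator_of_mem (mem_Ici.2 hxr), Pi.one_apply, mul_one, ← hle q le_rfl]
    exact measure_Ici_eq_of_tail
      (le_antisymm (tail_antitone hx.le) (hq1.trans (tail_antitone hxr)))
  · rw [indicator_of_notMem (by simpa using hxr), mul_zero,
      measure_mono_null (fun y hy => hxr.trans_le hy : Ici x ⊆ Ioi r) (E.le_reserve j)]

/-- The equilibria among sellers with equally many captive buyers. -/
theorem exists_common_distribution [Nonempty ι] :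
    ∃ ν : Measure ℝ, IsProbabilityMeasure ν ∧ (∀ x, ν {x} = 0) ∧
      ν.support = Icc (r * c / (1 + c)) r ∧ (∃ i j, i ≠ j ∧ σ i = ν ∧ σ j = ν) ∧
      ∀ i, σ i = ν ∨ σ i = Measure.dirac r ∨ ∃ q ∈ Ioo (r * c / (1 + c)) r,
        σ i = ν.restrict (Iio q) + ν (Ici q) • Measure.dirac r := by
  have := E.prob
  obtain ⟨a, b, hab, ha, hb⟩ := E.exists_two_always_active
  refine ⟨σ a, E.prob a, E.atomless ha, E.support_eq ha,
    ⟨a, b, hab, rfl, E.eq_of_always_active ha hb⟩, fun j => ?_⟩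
  by_cases hj : ∀ p < r, tail (σ j) r < tail (σ j) p
  · exact Or.inl (E.eq_of_always_active ha hj)
  push Not at hj
  obtain ⟨p, hp, hpj⟩ := hj
  right
  rcases le_or_gt 1 (tail (σ j) r) with h1 | h1
  · exact Or.inl (eq_dirac_of_tail (E.le_reserve j) h1)
  right
  -- The cutoff is the first point where the tail of `j` has come down to its value at `r`. That
  -- value is below one, so `q` exceeds the lowest price.
  obtain ⟨q, hqp, hq1, hq2⟩ := E.exists_min_level_below j (t := tail (σ j) r)
    (x₀ := r * c / (1 + c)) (by rwa [E.tail_lowest]) hpj hp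
  have hqr := hqp.trans_lt hp
  refine ⟨q, ⟨?_, hqr⟩, E.eq_cutoff ha hqr hq1 hq2⟩
  by_contra! hqL
  have h2 := tail_antitone (ν := σ j) hqL
  rw [E.tail_lowest] at h2
  linarith

end IsPricingEquilibrium

/-! ### Independent deviations -/

section Update

variable {ι : Type*} [Fintype ι] [DecidableEq ι]

lemma isProbabilityMeasure_update {σ : ι → Measure ℝ} [∀ i, IsProbabilityMeasure (σ i)] (i : ι)
    {τ : Measure ℝ} [IsProbabilityMeasure τ] (j : ι) :
    IsProbabilityMeasure (Function.update σ i τ j) := by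
  rcases eq_or_ne j i with rfl | h
  · rwa [Function.update_self]
  · rw [Function.update_of_ne h]; infer_instance

/-- The deviating price is drawn independently of a full profile, whose own coordinate is
overwritten. Fubini then writes a deviation profit as an integral over the own price. -/
lemma map_update_prod_pi (σ : ι → Measure ℝ) [∀ i, IsProbabilityMeasure (σ i)] (i : ι)
    (τ : Measure ℝ) [IsProbabilityMeasure τ] :
    (τ.prod (Measure.pi σ)).map (fun z => Function.update z.2 i z.1) =
      Measure.pi (Function.update σ i τ) := by
  have := isProbabilityMeasure_update (σ := σ) i (τ := τ)
  have hm : Measurable fun z : ℝ × (ι → ℝ) => Function.update z.2 i z.1 :=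
    (measurable_update' (a := i)).comp measurable_swap
  refine (Measure.pi_eq fun s hs => ?_).symm
  rw [Measure.map_apply hm (MeasurableSet.univ_pi hs)]
  have hpre : (fun z : ℝ × (ι → ℝ) => Function.update z.2 i z.1) ⁻¹' univ.pi s =
      s i ×ˢ univ.pi (Function.update s i univ) := by
    ext ⟨x, p⟩
    simp only [mem_preimage, mem_univ_pi, mem_prod]
    constructor
    · refine fun h => ⟨by simpa using h i, fun j => ?_⟩
      rcases eq_or_ne j i with rfl | hj
      · simp
      · simpa [hj] using h j
    · rintro ⟨h1, h2⟩ j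
      rcases eq_or_ne j i with rfl | hj
      · simpa using h1
      · simpa [hj] using h2 j
  rw [hpre, Measure.prod_prod, Measure.pi_pi, ← Finset.mul_prod_erase _ _ (Finset.mem_univ i),
    ← Finset.mul_prod_erase _ (fun j => Function.update σ i τ j (s j)) (Finset.mem_univ i)]
  simp only [Function.update_self, measure_univ, one_mul]
  congr 1
  refine Finset.prod_congr rfl fun j hj => ?_
  rw [Function.update_of_ne (Finset.ne_of_mem_erase hj),
    Function.update_of_ne (Finset.ne_of_mem_erase hj)]

lemma integral_prod_erase (σ : ι → Measure ℝ) [∀ i, IsProbabilityMeasure (σ i)] (i : ι)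
    (g : ι → ℝ → ℝ) : ∫ p, ∏ j ∈ Finset.univ.erase i, g j (p j) ∂(Measure.pi σ) =
      ∏ j ∈ Finset.univ.erase i, ∫ y, g j y ∂(σ j) := by
  have h := integral_fintype_prod_eq_prod (𝕜 := ℝ) (μ := σ)
    (fun j y => if j = i then (1 : ℝ) else g j y)
  simp only [← Finset.mul_prod_erase _ _ (Finset.mem_univ i), if_true, one_mul, integral_const,
    probReal_univ, smul_eq_mul, mul_one] at h
  have h2 : ∀ p : ι → ℝ, ∏ j ∈ Finset.univ.erase i, g j (p j) =
      ∏ j ∈ Finset.univ.erase i, if j = i then (1 : ℝ) else g j (p j) := fun p =>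
    Finset.prod_congr rfl fun j hj => (if_neg (Finset.ne_of_mem_erase hj)).symm
  simp only [h2, h]
  refine Finset.prod_congr rfl fun j hj => ?_
  simp [Finset.ne_of_mem_erase hj]

end Update

namespace StahlMarket

variable {ι : Type*} [Fintype ι] [DecidableEq ι] (m : StahlMarket ι)

/-! ### Shares of the buyers -/

lemma cheapestShare_nonneg (p : ι → ℝ) (i : ι) : 0 ≤ m.cheapestShare p i := by
  unfold cheapestShare
  split_ifs
  · exact div_nonneg (Nat.cast_nonneg _) (Finset.sum_nonneg fun _ _ => Nat.cast_nonneg _)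
  · rfl

lemma cheapestShare_le_one (p : ι → ℝ) (i : ι) : m.cheapestShare p i ≤ 1 := by
  unfold cheapestShare
  split_ifs with h
  · refine div_le_one_of_le₀ ?_ (Finset.sum_nonneg fun _ _ => Nat.cast_nonneg _)
    exact Finset.single_le_sum (f := fun j => (m.stores j : ℝ)) (fun _ _ => Nat.cast_nonneg _)
      (by simpa using h)
  · exact zero_le_one

lemma buyFrom_nonneg (r : ℝ) (p : ι → ℝ) (i : ι) (R : Finset ι) :
    ∀ j, 0 ≤ m.buyFrom r p j R i := by
  induction R using Finset.strongInduction with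
  | H R ih =>
    intro j
    rw [buyFrom]
    split_ifs
    · exact zero_le_one
    · rfl
    · exact m.cheapestShare_nonneg p i
    · exact Finset.sum_nonneg fun k _ => mul_nonneg (div_nonneg (Nat.cast_nonneg _)
        (Finset.sum_nonneg fun _ _ => Nat.cast_nonneg _)) (ih _ (Finset.erase_ssubset k.2) _)

lemma sum_weights (R : Finset ι) :
    ∑ k : {k // k ∈ R}, (m.stores k.1 : ℝ) / (∑ l ∈ R, (m.stores l : ℝ)) =
      (∑ l ∈ R, (m.stores l : ℝ)) / ∑ l ∈ R, (m.stores l : ℝ) := by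
  rw [Finset.sum_coe_sort R fun k => (m.stores k : ℝ) / ∑ l ∈ R, (m.stores l : ℝ),
    Finset.sum_div]

lemma buyFrom_le_one (r : ℝ) (p : ι → ℝ) (i : ι) (R : Finset ι) :
    ∀ j, m.buyFrom r p j R i ≤ 1 := by
  induction R using Finset.strongInduction with
  | H R ih =>
    intro j
    rw [buyFrom]
    split_ifs
    · rfl
    · exact zero_le_one
    · exact m.cheapestShare_le_one p i
    · refine (Finset.sum_le_sum fun k _ => mul_le_of_le_one_right (div_nonneg (Nat.cast_nonneg _)
        (Finset.sum_nonneg fun _ _ => Nat.cast_nonneg _)) (ih _ (Finset.erase_ssubset k.2) _)).trans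
        ?_
      rw [sum_weights]
      exact div_self_le_one _

lemma totalStores_nonneg : 0 ≤ m.totalStores := Finset.sum_nonneg fun _ _ => Nat.cast_nonneg _

lemma searcherShare_nonneg (r : ℝ) (p : ι → ℝ) (i : ι) : 0 ≤ m.searcherShare r p i :=
  Finset.sum_nonneg fun _ _ => mul_nonneg (div_nonneg (Nat.cast_nonneg _) m.totalStores_nonneg)
    (m.buyFrom_nonneg _ _ _ _ _)

lemma searcherShare_le_one (r : ℝ) (p : ι → ℝ) (i : ι) : m.searcherShare r p i ≤ 1 := by
  refine (Finset.sum_le_sum fun j _ => mul_le_of_le_one_right (div_nonneg (Nat.cast_nonneg _)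
    m.totalStores_nonneg) (m.buyFrom_le_one r p i _ j)).trans ?_
  rw [← Finset.sum_div]
  exact div_self_le_one _

lemma measurableSet_forall_le (i : ι) : MeasurableSet {p : ι → ℝ | ∀ j, p i ≤ p j} := by
  have : {p : ι → ℝ | ∀ j, p i ≤ p j} = ⋂ j, {p | p i ≤ p j} := by ext; simp
  rw [this]
  exact MeasurableSet.iInter fun j => measurableSet_le (measurable_pi_apply i) (measurable_pi_apply j)

lemma measurable_cheapestShare (i : ι) : Measurable fun p => m.cheapestShare p i := by
  simp only [cheapestShare, Finset.sum_filter]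
  refine Measurable.ite (measurableSet_forall_le i) (measurable_const.div ?_) measurable_const
  exact Finset.measurable_fun_sum _ fun j _ =>
    Measurable.ite (measurableSet_forall_le j) measurable_const measurable_const

lemma measurable_buyFrom (r : ℝ) (i : ι) (R : Finset ι) :
    ∀ j, Measurable fun p => m.buyFrom r p j R i := by
  induction R using Finset.strongInduction with
  | H R ih =>
    intro j
    simp only [buyFrom.eq_1 m r _ j R i]
    refine Measurable.ite (measurableSet_le (measurable_pi_apply j) measurable_const)
      measurable_const ?_
    split_ifs
    · exact m.measurable_cheapestShare i
    · exact Finset.measurable_fun_sum _ fun k _ =>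
        (ih _ (Finset.erase_ssubset k.2) _).const_mul _

lemma measurable_quantity (r : ℝ) (i : ι) : Measurable fun p => m.quantity r p i := by
  unfold quantity searcherShare
  refine ((m.measurable_cheapestShare i).const_mul _).add (Measurable.const_mul ?_ _)
  exact Finset.measurable_fun_sum _ fun j _ => (m.measurable_buyFrom r i _ j).const_mul _

variable {m}

namespace IsValid

lemma stores_cast_pos (hm : m.IsValid) (i : ι) : 0 < (m.stores i : ℝ) :=
  Nat.cast_pos.2 (hm.stores_pos i)

lemma totalStores_pos [Nonempty ι] (hm : m.IsValid) : 0 < m.totalStores :=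
  Finset.sum_pos (fun i _ => hm.stores_cast_pos i) Finset.univ_nonempty

lemma quantity_nonneg (hm : m.IsValid) (r : ℝ) (p : ι → ℝ) (i : ι) : 0 ≤ m.quantity r p i :=
  add_nonneg (mul_nonneg hm.shoppers_pos.le (m.cheapestShare_nonneg p i))
    (mul_nonneg (sub_nonneg.2 hm.shoppers_lt_one.le) (m.searcherShare_nonneg r p i))

lemma quantity_le_one (hm : m.IsValid) (r : ℝ) (p : ι → ℝ) (i : ι) : m.quantity r p i ≤ 1 := by
  have h1 := mul_le_mul_of_nonneg_left (m.cheapestShare_le_one p i) hm.shoppers_pos.le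
  have h2 := mul_le_mul_of_nonneg_left (m.searcherShare_le_one r p i)
    (sub_nonneg.2 hm.shoppers_lt_one.le)
  unfold quantity
  linarith

lemma buyFrom_eq_cheapestShare (hm : m.IsValid) {r : ℝ} {p : ι → ℝ} (i : ι) (h : ∀ j, r < p j)
    (R : Finset ι) : ∀ j, m.buyFrom r p j R i = m.cheapestShare p i := by
  induction R using Finset.strongInduction with
  | H R ih =>
    intro j
    rw [buyFrom, if_neg (not_le.2 (h j))]
    split_ifs with hR
    · rfl
    rw [Finset.sum_congr rfl fun k _ => by rw [ih _ (Finset.erase_ssubset k.2)],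
      ← Finset.sum_mul, sum_weights, div_self, one_mul]
    exact (Finset.sum_pos (fun l _ => hm.stores_cast_pos l)
      (Finset.nonempty_iff_ne_empty.2 hR)).ne'

end IsValid

/-- As long as an acceptable seller remains, the search stops at some acceptable price and never
comes to the final return to a cheapest store. -/
lemma buyFrom_eq_zero (m : StahlMarket ι) {r : ℝ} {p : ι → ℝ} {i l : ι} (hi : r < p i)
    (hl : p l ≤ r) (R : Finset ι) : ∀ j, l ∈ insert j R → m.buyFrom r p j R i = 0 := by
  induction R using Finset.strongInduction with
  | H R ih =>
    intro j hj
    rw [buyFrom]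
    by_cases hpj : p j ≤ r
    · rw [if_pos hpj, if_neg]
      rintro rfl
      exact absurd hpj (not_le.2 hi)
    rw [if_neg hpj]
    have hlR : l ∈ R := by
      rcases Finset.mem_insert.1 hj with rfl | h
      · exact absurd hl hpj
      · exact h
    rw [if_neg (Finset.ne_empty_of_mem hlR)]
    refine Finset.sum_eq_zero fun k _ => ?_
    rw [ih _ (Finset.erase_ssubset k.2) _ (by rwa [Finset.insert_erase k.2]), mul_zero]

/-- If all prices exceed `r`, searchers return to a cheapest store with the same tie weights as
shoppers; otherwise neither group buys at a price above `r`. -/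
lemma IsValid.quantity_of_lt [Nonempty ι] (hm : m.IsValid) {r : ℝ} {p : ι → ℝ} {i : ι}
    (hi : r < p i) : m.quantity r p i = m.cheapestShare p i := by
  suffices h : m.searcherShare r p i = m.cheapestShare p i by rw [quantity, h]; ring
  unfold searcherShare
  by_cases h : ∀ j, r < p j
  · simp only [hm.buyFrom_eq_cheapestShare i h]
    rw [← Finset.sum_mul, ← Finset.sum_div]
    exact (congrArg (· * _) (div_self hm.totalStores_pos.ne')).trans (one_mul _)
  · push Not at h
    obtain ⟨l, hl⟩ := h
    rw [cheapestShare, if_neg (fun h => by linarith [h l])]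
    refine Finset.sum_eq_zero fun j _ => ?_
    rw [buyFrom_eq_zero m hi hl _ j (by simp [Finset.insert_erase]), mul_zero]

lemma buyFrom_of_le (m : StahlMarket ι) {r : ℝ} {p : ι → ℝ} {j : ι} (h : p j ≤ r) (R : Finset ι)
    (i : ι) : m.buyFrom r p j R i = if i = j then 1 else 0 := by
  rw [buyFrom, if_pos h]

lemma searcherShare_of_forall_le (m : StahlMarket ι) {r : ℝ} {p : ι → ℝ} (h : ∀ j, p j ≤ r)
    (i : ι) : m.searcherShare r p i = m.stores i / m.totalStores := by
  simp [searcherShare, buyFrom_of_le m (h _)]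

lemma le_searcherShare (m : StahlMarket ι) {r : ℝ} {p : ι → ℝ} {i : ι} (h : p i ≤ r) :
    m.stores i / m.totalStores ≤ m.searcherShare r p i := by
  refine le_trans ?_ (Finset.single_le_sum (f := fun j => (m.stores j : ℝ) / m.totalStores *
    m.buyFrom r p j (Finset.univ.erase j) i) (fun j _ => mul_nonneg (div_nonneg (Nat.cast_nonneg _)
      m.totalStores_nonneg) (m.buyFrom_nonneg _ _ _ _ _)) (Finset.mem_univ i))
  simp [buyFrom_of_le m h]

/-! ### Expected share of the shoppers -/

variable (m) in
/-- The expected share of the shoppers who buy from seller `i` at price `x`. -/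
def expectedShare (σ : ι → Measure ℝ) (i : ι) (x : ℝ) : ℝ :=
  ∫ p, m.cheapestShare (Function.update p i x) i ∂(Measure.pi σ)

variable {σ : ι → Measure ℝ}

lemma measurable_update_right (i : ι) (x : ℝ) :
    Measurable fun p : ι → ℝ => Function.update p i x :=
  (measurable_update' (a := i)).comp (measurable_id.prodMk measurable_const)

lemma integrable_cheapestShare_update [∀ i, IsProbabilityMeasure (σ i)] (i : ι) (x : ℝ) :
    Integrable (fun p => m.cheapestShare (Function.update p i x) i) (Measure.pi σ) := by
  refine Integrable.of_bound ((m.measurable_cheapestShare i).comp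
    (measurable_update_right i x)).aestronglyMeasurable 1 (ae_of_all _ fun p => ?_)
  rw [Real.norm_of_nonneg (m.cheapestShare_nonneg _ _)]
  exact m.cheapestShare_le_one _ _

lemma expectedShare_nonneg (i : ι) (x : ℝ) : 0 ≤ m.expectedShare σ i x :=
  integral_nonneg fun _ => m.cheapestShare_nonneg _ _

lemma integral_indicator_const_one (ν : Measure ℝ) {s : Set ℝ} (hs : MeasurableSet s) :
    ∫ y, s.indicator (fun _ => (1 : ℝ)) y ∂ν = ν.real s := by
  rw [integral_indicator_const _ hs, smul_eq_mul, mul_one]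

lemma IsValid.cheapestShare_update_eq_one (hm : m.IsValid) {p : ι → ℝ} {i : ι} {x : ℝ}
    (h : ∀ j, j ≠ i → x < p j) : m.cheapestShare (Function.update p i x) i = 1 := by
  have h1 : ∀ j, Function.update p i x i ≤ Function.update p i x j := fun j => by
    rcases eq_or_ne j i with rfl | hj
    · rfl
    · simpa [hj] using (h j hj).le
  have h2 : (Finset.univ.filter fun j => ∀ k, Function.update p i x j ≤ Function.update p i x k) =
      {i} := by
    ext j
    simp only [Finset.mem_filter, Finset.mem_univ, true_and, Finset.mem_singleton]
    constructor
    · intro hj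
      by_contra hne
      have := hj i
      simp only [Function.update_self, Function.update_of_ne hne] at this
      exact absurd (h j hne) (not_lt.2 this)
    · rintro rfl
      exact h1
  rw [cheapestShare, if_pos h1, h2, Finset.sum_singleton, div_self (hm.stores_cast_pos i).ne']

/-- Together with `expectedShare_le_rivalTail` this encloses the share between products of open and
of closed tails; the two differ only through atoms. -/
lemma IsValid.le_expectedShare [∀ i, IsProbabilityMeasure (σ i)] (hm : m.IsValid) (i : ι) (x : ℝ) :
    ∏ j ∈ Finset.univ.erase i, (σ j).real (Ioi x) ≤ m.expectedShare σ i x := by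
  have h := integral_prod_erase σ i fun _ => (Ioi x).indicator fun _ => (1 : ℝ)
  simp only [integral_indicator_const_one _ measurableSet_Ioi] at h
  rw [← h]
  refine integral_mono_of_nonneg (ae_of_all _ fun p => Finset.prod_nonneg fun j _ =>
    indicator_nonneg (fun _ _ => zero_le_one) _) (integrable_cheapestShare_update i x)
    (ae_of_all _ fun p => ?_)
  beta_reduce
  by_cases hp : ∀ j, j ≠ i → x < p j
  · rw [hm.cheapestShare_update_eq_one hp]
    exact Finset.prod_le_one (fun j _ => indicator_nonneg (fun _ _ => zero_le_one) _)
      fun j _ => indicator_le_self' (fun _ _ => zero_le_one) _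
  · push Not at hp
    obtain ⟨j, hj, hjx⟩ := hp
    refine le_trans (Finset.prod_eq_zero (Finset.mem_erase.2 ⟨hj, Finset.mem_univ j⟩) ?_).le
      (m.cheapestShare_nonneg _ _)
    exact indicator_of_notMem (by simpa using hjx) _

lemma IsValid.cheapestShare_update_le (hm : m.IsValid) {p : ι → ℝ} {i b : ι} (hb : b ≠ i)
    {x : ℝ} (hx : p b = x) : m.cheapestShare (Function.update p i x) i ≤
      m.stores i / (m.stores i + m.stores b) := by
  have hi := hm.stores_cast_pos i
  have hbp := hm.stores_cast_pos b
  unfold cheapestShare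
  split_ifs with h
  · refine div_le_div_of_nonneg_left hi.le (by positivity) ?_
    rw [← Finset.sum_pair hb.symm (f := fun j => (m.stores j : ℝ))]
    refine Finset.sum_le_sum_of_subset_of_nonneg (fun j hj => ?_) fun _ _ _ => Nat.cast_nonneg _
    simp only [Finset.mem_filter, Finset.mem_univ, true_and]
    rcases Finset.mem_insert.1 hj with rfl | hj
    · exact h
    · rw [Finset.mem_singleton.1 hj]
      intro k
      have := h k
      rw [Function.update_self] at this
      rwa [Function.update_of_ne hb, hx]
  · positivity

/-- The expected share is below the probability of the rivals' prices being at least `x`, with a loss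
from ties with seller `b`. -/
lemma IsValid.expectedShare_le [∀ i, IsProbabilityMeasure (σ i)] (hm : m.IsValid) {i b : ι}
    (hb : i ≠ b) (x : ℝ) : m.expectedShare σ i x ≤ (tail (σ b) x -
      m.stores b / (m.stores i + m.stores b) * (σ b).real {x}) *
        ∏ l ∈ (Finset.univ.erase i).erase b, tail (σ l) x := by
  have hi := hm.stores_cast_pos i
  have hbp := hm.stores_cast_pos b
  set c : ℝ := m.stores b / (m.stores i + m.stores b) with hc
  have hc0 : 0 ≤ c := by positivity
  have hc1 : 1 - c = m.stores i / (m.stores i + m.stores b) := by rw [hc]; field_simp; ring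
  have hc1' : 0 ≤ 1 - c := by rw [hc1]; positivity
  -- The product of the `g j` dominates the share pointwise and factorizes under independence. The
  -- deduction `c` at `x` is the least part that `i` loses in a tie with `b`.
  set g : ι → ℝ → ℝ := fun j y => (Ici x).indicator (fun _ => (1 : ℝ)) y -
    if j = b then c * ({x} : Set ℝ).indicator (fun _ => (1 : ℝ)) y else 0 with hg
  have hg0 : ∀ j y, 0 ≤ g j y := fun j y => by
    simp only [hg, indicator, mem_Ici, mem_singleton_iff]
    split_ifs <;> linarith
  have hgx : ∀ j y, x ≤ y → g j y = if j = b ∧ y = x then 1 - c else 1 := fun j y hy => by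
    simp only [hg, indicator, mem_Ici, mem_singleton_iff, hy, if_true]
    by_cases h1 : j = b <;> by_cases h2 : y = x <;> simp [h1, h2]
  have hint : ∀ j, ∫ y, g j y ∂σ j = tail (σ j) x - if j = b then c * (σ j).real {x} else 0 := by
    intro j
    have h1 : Integrable ((Ici x).indicator fun _ => (1 : ℝ)) (σ j) :=
      (integrable_const _).indicator measurableSet_Ici
    have h2 : Integrable (({x} : Set ℝ).indicator fun _ => (1 : ℝ)) (σ j) :=
      (integrable_const _).indicator (measurableSet_singleton x)
    by_cases hj : j = b
    · simp only [hg, hj, if_true]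
      subst hj
      rw [integral_sub h1 (h2.const_mul c), integral_const_mul,
        integral_indicator_const_one _ measurableSet_Ici,
        integral_indicator_const_one _ (measurableSet_singleton x), tail]
    · simp only [hg, hj, if_false, sub_zero]
      rw [integral_indicator_const_one _ measurableSet_Ici, tail]
  have h := integral_prod_erase σ i g
  simp only [hint] at h
  rw [← Finset.mul_prod_erase _ _ (Finset.mem_erase.2 ⟨hb.symm, Finset.mem_univ b⟩), if_pos rfl] at h
  rw [Finset.prod_congr rfl fun l hl => by rw [if_neg (Finset.ne_of_mem_erase hl), sub_zero]] at h
  rw [← h]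
  have hbound : ∀ p : ι → ℝ, ∏ j ∈ Finset.univ.erase i, g j (p j) ≤ 1 := fun p =>
    Finset.prod_le_one (fun _ _ => hg0 _ _) fun j _ => by
      simp only [hg, indicator, mem_Ici, mem_singleton_iff]
      split_ifs <;> linarith
  refine integral_mono (integrable_cheapestShare_update i x) ?_ fun p => ?_
  · refine Integrable.of_bound (Measurable.aestronglyMeasurable ?_) 1 (ae_of_all _ fun p => ?_)
    · refine Finset.measurable_fun_prod _ fun j _ => Measurable.comp (g := g j) ?_ (measurable_pi_apply j)
      refine (measurable_const.indicator measurableSet_Ici).sub ?_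
      split_ifs
      · exact (measurable_const.indicator (measurableSet_singleton x)).const_mul c
      · exact measurable_const
    · rw [Real.norm_of_nonneg (Finset.prod_nonneg fun _ _ => hg0 _ _)]
      exact hbound p
  · by_cases hp : ∀ j, j ≠ i → x ≤ p j
    · have h1 : ∏ j ∈ Finset.univ.erase i, g j (p j) = if p b = x then 1 - c else 1 := by
        rw [← Finset.mul_prod_erase _ _ (Finset.mem_erase.2 ⟨hb.symm, Finset.mem_univ b⟩),
          hgx b _ (hp b hb.symm), Finset.prod_eq_one, mul_one]
        · simp
        · intro j hj
          rw [hgx j _ (hp j (Finset.ne_of_mem_erase (Finset.mem_of_mem_erase hj))),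
            if_neg fun h => Finset.ne_of_mem_erase hj h.1]
      simp only [h1]
      split_ifs with hx
      · rw [hc1]; exact hm.cheapestShare_update_le hb.symm hx
      · exact m.cheapestShare_le_one _ _
    · push Not at hp
      obtain ⟨j, hj, hjx⟩ := hp
      refine le_trans (le_of_eq ?_) (Finset.prod_nonneg fun _ _ => hg0 _ _)
      refine if_neg fun h => ?_
      have := h j
      simp only [Function.update_self, Function.update_of_ne hj] at this
      linarith

lemma IsValid.expectedShare_le_rivalTail [Nontrivial ι] [∀ i, IsProbabilityMeasure (σ i)]
    (hm : m.IsValid) (i : ι) (x : ℝ) : m.expectedShare σ i x ≤ rivalTail σ i x := by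
  obtain ⟨b, hb⟩ := exists_ne i
  refine (hm.expectedShare_le hb.symm x).trans ?_
  rw [rivalTail_eq_mul σ hb.symm]
  refine mul_le_mul_of_nonneg_right ?_ (Finset.prod_nonneg fun _ _ => tail_nonneg _ _)
  have := mul_nonneg (div_nonneg (Nat.cast_nonneg (m.stores b)) (add_nonneg
    (Nat.cast_nonneg (m.stores i)) (Nat.cast_nonneg (m.stores b))) : (0 : ℝ) ≤ _)
    (measureReal_nonneg (μ := σ b) (s := {x}))
  linarith

/-- Undercutting: a bound on the profit from prices slightly below `v` extends to the profit which a
seller would have at `v` if all ties were decided in its favour. -/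
lemma IsValid.undercut [∀ i, IsProbabilityMeasure (σ i)] (hm : m.IsValid) {i : ι}
    {a v A B P : ℝ} (ha : 0 ≤ a) (hav : a < v) (hA : 0 ≤ A)
    (h : ∀ x ∈ Ioo a v, x * (A * m.expectedShare σ i x + B) ≤ P) :
    v * (A * rivalTail σ i v + B) ≤ P := by
  have ht : Tendsto (fun x => x * (A * rivalTail σ i v + B)) (𝓝[<] v)
      (𝓝 (v * (A * rivalTail σ i v + B))) :=
    (tendsto_id.mul_const _).mono_left nhdsWithin_le_nhds
  refine le_of_tendsto ht ?_
  filter_upwards [Ioo_mem_nhdsLT hav] with x hx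
  refine le_trans (mul_le_mul_of_nonneg_left ?_ (ha.trans hx.1.le)) (h x hx)
  -- Open tails at `x < v` contain the closed tails at `v`.
  have h1 : rivalTail σ i v ≤ ∏ j ∈ Finset.univ.erase i, (σ j).real (Ioi x) :=
    Finset.prod_le_prod (fun _ _ => tail_nonneg _ _)
      fun j _ => measureReal_mono fun y hy => hx.2.trans_le hy
  have := mul_le_mul_of_nonneg_left (h1.trans (hm.le_expectedShare i x)) hA
  linarith

/-- A seller who cannot gain by undercutting does not tie. -/
lemma IsValid.no_tie [∀ i, IsProbabilityMeasure (σ i)] (hm : m.IsValid) {i b : ι} (hib : i ≠ b)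
    {a v A B P : ℝ} (ha : 0 ≤ a) (hav : a < v) (hA : 0 < A)
    (h : ∀ x ∈ Ioo a v, x * (A * m.expectedShare σ i x + B) ≤ P)
    (hv : v * (A * m.expectedShare σ i v + B) = P) (hb : 0 < σ b {v}) :
    ∏ l ∈ (Finset.univ.erase i).erase b, tail (σ l) v = 0 := by
  have h1 := hm.undercut ha hav hA.le h
  have h2 := hm.expectedShare_le (σ := σ) hib v
  rw [rivalTail_eq_mul σ hib] at h1
  set Q := ∏ l ∈ (Finset.univ.erase i).erase b, tail (σ l) v
  have hQ : 0 ≤ Q := Finset.prod_nonneg fun _ _ => tail_nonneg _ _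
  have hc : 0 < (m.stores b : ℝ) / (m.stores i + m.stores b) * (σ b).real {v} :=
    mul_pos (div_pos (hm.stores_cast_pos b)
      (add_pos (hm.stores_cast_pos i) (hm.stores_cast_pos b)))
      (ENNReal.toReal_pos hb.ne' (measure_ne_top _ _))
  set c := (m.stores b : ℝ) / (m.stores i + m.stores b) * (σ b).real {v}
  rw [← hv] at h1
  have h3 := le_of_mul_le_mul_left h1 (ha.trans_lt hav)
  have h4 : tail (σ b) v * Q ≤ m.expectedShare σ i v :=
    le_of_mul_le_mul_left (by linarith : A * _ ≤ A * _) hA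
  have h5 : c * Q ≤ 0 := by linarith [sub_mul (tail (σ b) v) c Q]
  exact le_antisymm (by_contra fun hQ' => absurd (mul_pos hc (not_le.1 hQ')) (not_lt.2 h5)) hQ

end StahlMarket

namespace StahlMarket

variable {ι : Type*} [Fintype ι] [DecidableEq ι] {m : StahlMarket ι} {r : ℝ} {σ : ι → Measure ℝ}

/-! ### Profits -/

variable (m r σ) in
/-- The expected profit of seller `i` at price `x`. -/
def priceProfit (i : ι) (x : ℝ) : ℝ :=
  ∫ p, x * m.quantity r (Function.update p i x) i ∂(Measure.pi σ)

lemma IsStrategy.ae_mem {τ : Measure ℝ} (h : m.IsStrategy τ) : ∀ᵐ x ∂τ, x ∈ Icc 0 m.maxPrice := by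
  rw [ae_iff]
  exact h.2

lemma IsValid.integrable_deviation [∀ i, IsProbabilityMeasure (σ i)] (hm : m.IsValid) (i : ι)
    {τ : Measure ℝ} (hτ : m.IsStrategy τ) :
    Integrable (fun z : ℝ × (ι → ℝ) => z.1 * m.quantity r (Function.update z.2 i z.1) i)
      (τ.prod (Measure.pi σ)) := by
  have := hτ.1
  have hme : Measurable fun z : ℝ × (ι → ℝ) => Function.update z.2 i z.1 :=
    (measurable_update' (a := i)).comp measurable_swap
  refine Integrable.of_bound (measurable_fst.mul
    ((m.measurable_quantity r i).comp hme)).aestronglyMeasurable m.maxPrice ?_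
  have h := Measure.quasiMeasurePreserving_fst (μ := τ) (ν := Measure.pi σ) |>.ae hτ.ae_mem
  filter_upwards [h] with z hz
  rw [Real.norm_of_nonneg (mul_nonneg hz.1 (hm.quantity_nonneg _ _ _))]
  exact (mul_le_of_le_one_right hz.1 (hm.quantity_le_one _ _ _)).trans hz.2

lemma IsValid.integrable_priceProfit [∀ i, IsProbabilityMeasure (σ i)] (hm : m.IsValid) (i : ι)
    {τ : Measure ℝ} (hτ : m.IsStrategy τ) : Integrable (m.priceProfit r σ i) τ := by
  have := hτ.1
  exact (hm.integrable_deviation i hτ).integral_prod_left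

lemma IsValid.profit_update [∀ i, IsProbabilityMeasure (σ i)] (hm : m.IsValid) (i : ι)
    {τ : Measure ℝ} (hτ : m.IsStrategy τ) :
    m.profit r (Function.update σ i τ) i = ∫ x, m.priceProfit r σ i x ∂τ := by
  have := hτ.1
  have hme : Measurable fun z : ℝ × (ι → ℝ) => Function.update z.2 i z.1 :=
    (measurable_update' (a := i)).comp measurable_swap
  have hq : Measurable fun p : ι → ℝ => p i * m.quantity r p i :=
    (measurable_pi_apply i).mul (m.measurable_quantity r i)
  rw [profit, ← map_update_prod_pi, integral_map hme.aemeasurable hq.aestronglyMeasurable]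
  simp only [Function.update_self]
  exact integral_prod _ (hm.integrable_deviation i hτ)

lemma IsValid.profit_eq_integral [∀ i, IsProbabilityMeasure (σ i)] (hm : m.IsValid) (i : ι)
    (hσ : m.IsStrategy (σ i)) : m.profit r σ i = ∫ x, m.priceProfit r σ i x ∂(σ i) := by
  rw [← hm.profit_update i hσ, Function.update_eq_self]

lemma isStrategy_dirac {x : ℝ} (hx : x ∈ Icc 0 m.maxPrice) : m.IsStrategy (Measure.dirac x) := by
  refine ⟨inferInstance, ?_⟩
  rw [Measure.dirac_apply' _ measurableSet_Icc.compl, indicator_of_notMem (by simpa using hx)]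

lemma IsValid.priceProfit_of_lt [Nonempty ι] (hm : m.IsValid) {i : ι} {x : ℝ} (hx : r < x) :
    m.priceProfit r σ i x = x * m.expectedShare σ i x := by
  rw [priceProfit, expectedShare, integral_const_mul]
  congr 2
  ext p
  exact hm.quantity_of_lt (by rwa [Function.update_self])

lemma priceProfit_of_le [∀ i, IsProbabilityMeasure (σ i)] (h : ∀ i, σ i (Ioi r) = 0) {i : ι}
    {x : ℝ} (hx : x ≤ r) : m.priceProfit r σ i x = x * (m.shoppers * m.expectedShare σ i x +
      (1 - m.shoppers) * (m.stores i / m.totalStores)) := by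
  have h1 : ∀ᵐ p ∂(Measure.pi σ), ∀ j, p j ≤ r := ae_all_iff.2 fun j =>
    (Measure.tendsto_eval_ae_ae (μ := σ) (i := j)).eventually (p := fun y => y ≤ r) (by
      rw [ae_iff]
      simpa [Ioi] using h j)
  rw [priceProfit, integral_const_mul]
  congr 1
  rw [integral_congr_ae (g := fun p => m.shoppers * m.cheapestShare (Function.update p i x) i +
    (1 - m.shoppers) * (m.stores i / m.totalStores))]
  · rw [integral_add ((integrable_cheapestShare_update i x).const_mul _) (integrable_const _),
      integral_const_mul, integral_const, probReal_univ, one_smul, expectedShare]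
  · filter_upwards [h1] with p hp
    rw [quantity, searcherShare_of_forall_le]
    intro j
    rcases eq_or_ne j i with rfl | hj
    · rwa [Function.update_self]
    · rw [Function.update_of_ne hj]
      exact hp j

/-- No bound on the rivals' prices is assumed, so this yields positive profits before prices above
`r` are excluded. -/
lemma IsValid.le_priceProfit [∀ i, IsProbabilityMeasure (σ i)] (hm : m.IsValid) {i : ι}
    {x : ℝ} (hx0 : 0 ≤ x) (hx : x ≤ r) :
    x * ((1 - m.shoppers) * (m.stores i / m.totalStores)) ≤ m.priceProfit r σ i x := by
  have h : Integrable (fun p => m.quantity r (Function.update p i x) i) (Measure.pi σ) := by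
    refine Integrable.of_bound ((m.measurable_quantity r i).comp
      (measurable_update_right i x)).aestronglyMeasurable 1 (ae_of_all _ fun p => ?_)
    rw [Real.norm_of_nonneg (hm.quantity_nonneg _ _ _)]
    exact hm.quantity_le_one _ _ _
  rw [priceProfit, integral_const_mul]
  refine mul_le_mul_of_nonneg_left ?_ hx0
  have h2 := integral_mono (μ := Measure.pi σ)
    (integrable_const ((1 - m.shoppers) * (m.stores i / m.totalStores))) h fun p => by
      have h3 := le_searcherShare m (r := r) (p := Function.update p i x) (i := i)
        (by rwa [Function.update_self])
      have h4 := mul_le_mul_of_nonneg_left h3 (sub_nonneg.2 hm.shoppers_lt_one.le)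
      have h5 := mul_nonneg hm.shoppers_pos.le (m.cheapestShare_nonneg (Function.update p i x) i)
      unfold quantity
      linarith
  rwa [integral_const, probReal_univ, one_smul] at h2

lemma IsValid.reserve_pos (hm : m.IsValid) (h : m.IsReservePrice r) : 0 < r := by
  have hc := hm.searchCost_pos
  have hM := hm.maxPrice_pos
  have hmin := lt_min hc hM
  have h1 := min_le_left m.searchCost m.maxPrice
  have h2 := min_le_right m.searchCost m.maxPrice
  -- An admissible positive price below the search cost, hence accepted.
  have := h.2 (min m.searchCost m.maxPrice / 2) ⟨by linarith, by linarith⟩ (by linarith)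
  linarith

/-! ### From market equilibria to the pricing game -/

namespace IsReservePriceEquilibrium

variable (hσ : m.IsReservePriceEquilibrium r σ) (hm : m.IsValid)
include hσ

lemma prob (i : ι) : IsProbabilityMeasure (σ i) := (hσ.strategy i).1

include hm

lemma priceProfit_le (i : ι) {x : ℝ} (hx : x ∈ Icc 0 m.maxPrice) :
    m.priceProfit r σ i x ≤ m.profit r σ i := by
  have := hσ.prob
  have h := hσ.no_deviation i _ (isStrategy_dirac hx)
  rwa [hm.profit_update i (isStrategy_dirac hx), integral_dirac] at h

/-- The equilibrium profit is the mean of `priceProfit` under `σ i` and also its upper bound on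
admissible prices. -/
lemma ae_priceProfit_eq (i : ι) : ∀ᵐ x ∂σ i, m.priceProfit r σ i x = m.profit r σ i := by
  have := hσ.prob
  have hi := hm.integrable_priceProfit (r := r) (σ := σ) i (hσ.strategy i)
  have h0 : ∫ x, (m.profit r σ i - m.priceProfit r σ i x) ∂σ i = 0 := by
    rw [integral_sub (integrable_const _) hi, ← hm.profit_eq_integral i (hσ.strategy i)]
    simp
  have h1 := (integral_eq_zero_iff_of_nonneg_ae (by
    filter_upwards [(hσ.strategy i).ae_mem] with x hx
    exact sub_nonneg.2 (hσ.priceProfit_le hm i hx)) ((integrable_const _).sub hi)).1 h0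
  filter_upwards [h1] with x hx
  have : m.profit r σ i - m.priceProfit r σ i x = 0 := hx
  linarith

lemma priceProfit_eq_of_atom (i : ι) {x : ℝ} (h : 0 < σ i {x}) :
    m.priceProfit r σ i x = m.profit r σ i ∧ x ∈ Icc 0 m.maxPrice := by
  by_contra hne
  exact h.ne' (measure_mono_null (by simpa using hne)
    (ae_iff.1 ((hσ.ae_priceProfit_eq hm i).and (hσ.strategy i).ae_mem)))

lemma profit_pos [Nonempty ι] (i : ι) : 0 < m.profit r σ i := by
  have := hσ.prob
  have hr := hm.reserve_pos hσ.reserve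
  refine lt_of_lt_of_le ?_ ((hm.le_priceProfit hr.le le_rfl).trans
    (hσ.priceProfit_le hm i hσ.reserve.1))
  exact mul_pos hr (mul_pos (sub_pos.2 hm.shoppers_lt_one)
    (div_pos (hm.stores_cast_pos i) hm.totalStores_pos))

/-- No seller charges prices above the reserve price. -/
theorem measure_Ioi_eq_zero [Nontrivial ι] (a : ι) : σ a (Ioi r) = 0 := by
  have := hσ.prob
  have hr := hm.reserve_pos hσ.reserve
  have hM := hm.maxPrice_pos
  by_contra hne
  obtain ⟨b, hba⟩ := exists_ne a
  have hMnull : ∀ i, σ i (Ioi m.maxPrice) = 0 := fun i =>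
    measure_mono_null (t := (Icc 0 m.maxPrice)ᶜ) (fun x hx h => absurd h.2 (not_le.2 hx))
      (hσ.strategy i).2
  have key : ∀ {a b : ι}, a ≠ b →
      ∀ᵐ p ∂σ a, r < p → m.profit r σ a / m.maxPrice ≤ tail (σ b) p := by
    intro a b hab
    filter_upwards [hσ.ae_priceProfit_eq hm a, (hσ.strategy a).ae_mem] with p h1 h2 h3
    rw [hm.priceProfit_of_lt h3] at h1
    rw [div_le_iff₀ hM, ← h1, mul_comm]
    have h4 := (hm.expectedShare_le_rivalTail (σ := σ) a p).trans (rivalTail_le_tail hab p)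
    exact mul_le_mul h4 h2.2 h2.1 (tail_nonneg _ _)
  obtain ⟨v, hrv, hva, hvb⟩ := exists_common_atom (μ := σ a) (ν := σ b) (r := r) (R := m.maxPrice)
    (δ := min (m.profit r σ a / m.maxPrice) (m.profit r σ b / m.maxPrice))
    (lt_min (div_pos (hσ.profit_pos hm a) hM) (div_pos (hσ.profit_pos hm b) hM))
    (hMnull a) (hMnull b)
    (by filter_upwards [key hba.symm] with p h hp using (min_le_left _ _).trans (h hp))
    (by filter_upwards [key hba] with p h hp using (min_le_right _ _).trans (h hp))
    (pos_iff_ne_zero.2 hne)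
  obtain ⟨h1, h2⟩ := hσ.priceProfit_eq_of_atom hm a hva
  rw [hm.priceProfit_of_lt hrv] at h1
  -- All buyers compare prices above `r`, so the weight of the share is one and there is no captive
  -- part.
  have h3 := hm.no_tie hba.symm hr.le hrv one_pos (B := 0) (P := m.profit r σ a) (fun x hx => by
    rw [one_mul, add_zero, ← hm.priceProfit_of_lt hx.1]
    exact hσ.priceProfit_le hm a ⟨(hr.trans hx.1).le, hx.2.le.trans h2.2⟩)
    (by rw [one_mul, add_zero, h1]) hvb
  have h4 := hm.expectedShare_le (σ := σ) hba.symm v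
  rw [h3, mul_zero] at h4
  have h5 := hσ.profit_pos hm a
  have h6 := mul_nonpos_of_nonneg_of_nonpos (hr.trans hrv).le h4
  linarith

/-- The equilibrium as one of the pricing game with captive buyers. -/
theorem isPricingEquilibrium [Nontrivial ι] : IsPricingEquilibrium r
    (fun i => (1 - m.shoppers) * (m.stores i / m.totalStores) / m.shoppers)
    (fun i => m.profit r σ i / m.shoppers) σ := by
  have := hσ.prob
  have hr := hm.reserve_pos hσ.reserve
  have hμ := hm.shoppers_pos
  have hnull := hσ.measure_Ioi_eq_zero hm
  have hscale : ∀ x y B : ℝ, x * (y + B / m.shoppers) = x * (m.shoppers * y + B) / m.shoppers :=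
    fun x y B => by field_simp
  have hcap : ∀ i, 0 < (1 - m.shoppers) * (m.stores i / m.totalStores) := fun i =>
    mul_pos (sub_pos.2 hm.shoppers_lt_one) (div_pos (hm.stores_cast_pos i) hm.totalStores_pos)
  have hdev : ∀ i, ∀ x ∈ Icc 0 r, x * (m.shoppers * m.expectedShare σ i x +
      (1 - m.shoppers) * (m.stores i / m.totalStores)) ≤ m.profit r σ i := fun i x hx => by
    rw [← priceProfit_of_le hnull hx.2]
    exact hσ.priceProfit_le hm i ⟨hx.1, hx.2.trans hσ.reserve.1.2⟩
  have hle : ∀ i, ∀ x ≤ r, x * (m.shoppers * rivalTail σ i x +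
      (1 - m.shoppers) * (m.stores i / m.totalStores)) ≤ m.profit r σ i := fun i x hx => by
    rcases le_or_gt x 0 with hx0 | hx0
    · exact (mul_nonpos_of_nonpos_of_nonneg hx0 (add_nonneg
        (mul_nonneg hμ.le (rivalTail_nonneg _ _ _)) (hcap i).le)).trans (hσ.profit_pos hm i).le
    · exact hm.undercut le_rfl hx0 hμ.le fun y hy => hdev i y ⟨hy.1.le, hy.2.le.trans hx⟩
  have hatom : ∀ i x, 0 < σ i {x} → x ≤ r := fun i x hx => by
    by_contra! h
    exact hx.ne' (measure_mono_null (by simpa using h) (hnull i))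
  refine ⟨hσ.prob, hr, fun i => div_pos (hcap i) hμ, hnull, fun i x hx => ?_, fun i => ?_,
    fun i j x hij hi hj => ?_⟩
  · rw [hscale, div_le_div_iff_of_pos_right hμ]
    exact hle i x hx
  · have hir : ∀ᵐ x ∂σ i, x ≤ r := by rw [ae_iff]; simpa [Ioi] using hnull i
    filter_upwards [hσ.ae_priceProfit_eq hm i, (hσ.strategy i).ae_mem, hir] with x h1 h2 h3
    rw [hscale]
    congr 1
    -- The actual profit at a charged price is at most the one with ties won, and undercutting
    -- bounds the latter by the equilibrium profit.
    refine le_antisymm (hle i x h3) ?_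
    rw [← h1, priceProfit_of_le hnull h3]
    refine mul_le_mul_of_nonneg_left ?_ h2.1
    have := mul_le_mul_of_nonneg_left (hm.expectedShare_le_rivalTail (σ := σ) i x) hμ.le
    linarith
  · obtain ⟨h1, h2⟩ := hσ.priceProfit_eq_of_atom hm i hi
    rw [priceProfit_of_le hnull (hatom i x hi)] at h1
    have hx0 : 0 < x := by
      refine h2.1.lt_of_ne fun h0 => ?_
      rw [← h0, zero_mul] at h1
      exact (hσ.profit_pos hm i).ne h1
    exact hm.no_tie hij le_rfl hx0 hμ
      (fun y hy => hdev i y ⟨hy.1.le, hy.2.le.trans (hatom i x hi)⟩) h1 hj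

end IsReservePriceEquilibrium

/-! ### Markets in which all sellers have equally many captive buyers -/

section Symmetric

variable {c : ℝ} [Nontrivial ι] (hm : m.IsValid) (hr : m.IsReservePrice r)
  (hs : ∀ i, m.IsStrategy (σ i))
  (E : IsPricingEquilibrium r (fun _ => c) (fun _ => r * c) σ)
  (hc : ∀ i, (1 - m.shoppers) * (m.stores i / m.totalStores) = m.shoppers * c)
include hm hs E hc

/-- Up to `r` the profit with ties won is an upper bound; above `r` a rival is almost surely cheaper
and nothing is sold. -/
lemma priceProfit_le_of_isPricingEquilibrium (i : ι) {x : ℝ} (hx : 0 ≤ x) :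
    m.priceProfit r σ i x ≤ m.shoppers * (r * c) := by
  have := E.prob
  have hμ := hm.shoppers_pos
  have h1 := mul_le_mul_of_nonneg_left (hm.expectedShare_le_rivalTail (σ := σ) i x) hx
  rcases le_or_gt x r with hxr | hxr
  · rw [priceProfit_of_le E.le_reserve hxr, hc]
    have h2 := mul_le_mul_of_nonneg_left (E.profit_le i x hxr) hμ.le
    have h3 := mul_le_mul_of_nonneg_left h1 hμ.le
    linarith
  · rw [hm.priceProfit_of_lt hxr]
    obtain ⟨b, hb⟩ := exists_ne i
    rw [rivalTail_eq_mul σ hb.symm, E.tail_eq_zero b hxr, zero_mul, mul_zero] at h1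
    exact h1.trans (mul_pos hμ (mul_pos E.reserve_pos (E.captive_pos i))).le

lemma profit_eq_of_isPricingEquilibrium (i : ι) : m.profit r σ i = m.shoppers * (r * c) := by
  have := E.prob
  have hμ := hm.shoppers_pos
  rw [hm.profit_eq_integral i (hs i), integral_congr_ae (g := fun _ => m.shoppers * (r * c))]
  · simp
  filter_upwards [E.profit_eq i, E.ae_le_reserve i] with x h1 hxr
  have hx0 := E.pos_of_eq h1
  refine le_antisymm (priceProfit_le_of_isPricingEquilibrium hm hs E hc i hx0.le) ?_
  rw [priceProfit_of_le E.le_reserve hxr, hc, ← h1]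
  -- No profit is lost in ties: there are no atoms below `r`, and at `r` the joint tail is zero.
  have h2 : rivalTail σ i x ≤ m.expectedShare σ i x := by
    rcases hxr.lt_or_eq with hxr | rfl
    · refine le_trans (le_of_eq ?_) (hm.le_expectedShare i x)
      exact Finset.prod_congr rfl fun j _ => tail_eq_Ioi (E.atomless_below j hxr)
    · rw [E.rivalTail_reserve_eq_zero]
      exact expectedShare_nonneg i _
  have h3 := mul_le_mul_of_nonneg_left h2 (mul_nonneg hμ.le hx0.le)
  linarith

include hr

lemma isReservePriceEquilibrium_of_isPricingEquilibrium : m.IsReservePriceEquilibrium r σ := by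
  have := E.prob
  refine ⟨hr, hs, fun i τ hτ => ?_⟩
  have := hτ.1
  rw [hm.profit_update i hτ, profit_eq_of_isPricingEquilibrium hm hs E hc]
  have h := integral_mono_ae (hm.integrable_priceProfit (r := r) (σ := σ) i hτ)
    (integrable_const (m.shoppers * (r * c))) (by
      filter_upwards [hτ.ae_mem] with x hx
      exact priceProfit_le_of_isPricingEquilibrium hm hs E hc i hx.1)
  simpa using h

end Symmetric

/-! ### The market of the smallest sellers -/

lemma rivalTail_subtype {P : ι → Prop} [DecidablePred P] {x : ℝ}
    (h : ∀ j, ¬ P j → tail (σ j) x = 1) (i : {i // P i}) :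
    rivalTail (fun j : {i // P i} => σ j.1) i x = rivalTail σ i.1 x := by
  unfold rivalTail
  refine Finset.prod_of_injOn Subtype.val Subtype.val_injective.injOn ?_ ?_ fun _ _ => rfl
  · intro j hj
    have hj' : j ≠ i := by simpa using hj
    simpa [Subtype.ext_iff] using hj'
  · intro j hj hj'
    refine h j fun hP => hj' ⟨⟨j, hP⟩, ?_, rfl⟩
    simpa [Subtype.ext_iff] using Finset.ne_of_mem_erase hj

lemma rivalPairTail_subtype {P : ι → Prop} [DecidablePred P] {x : ℝ}
    (h : ∀ j, ¬ P j → tail (σ j) x = 1) (i k : {i // P i}) :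
    ∏ l ∈ (Finset.univ.erase i).erase k, tail (σ l.1) x =
      ∏ l ∈ (Finset.univ.erase i.1).erase k.1, tail (σ l) x := by
  refine Finset.prod_of_injOn Subtype.val Subtype.val_injective.injOn ?_ ?_ fun _ _ => rfl
  · intro j hj
    have hj' : j ≠ i ∧ j ≠ k := by simpa using hj
    simpa [Subtype.ext_iff] using hj'
  · intro j hj hj'
    refine h j fun hP => hj' ⟨⟨j, hP⟩, ?_, rfl⟩
    simpa [Subtype.ext_iff, and_comm] using hj

end StahlMarket

/-- Sellers outside a group who choose the reserve price can be disregarded. -/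
lemma IsPricingEquilibrium.subtype {ι : Type*} [Fintype ι] [DecidableEq ι] {r : ℝ} {α π : ι → ℝ}
    {σ : ι → Measure ℝ} (E : IsPricingEquilibrium r α π σ) {P : ι → Prop} [DecidablePred P]
    (h : ∀ j, ¬ P j → σ j = Measure.dirac r) :
    IsPricingEquilibrium r (fun i : {i // P i} => α i.1) (fun i => π i.1) (fun i => σ i.1) := by
  have htail : ∀ x ≤ r, ∀ j, ¬ P j → tail (σ j) x = 1 := fun x hx j hj => by
    rw [h j hj, tail, Measure.real, Measure.dirac_apply' _ measurableSet_Ici,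
      indicator_of_mem (mem_Ici.2 hx), Pi.one_apply, ENNReal.toReal_one]
  refine ⟨fun i => E.prob i, E.reserve_pos, fun i => E.captive_pos i, fun i => E.le_reserve i,
    fun i x hx => ?_, fun i => ?_, fun i j x hij hi hj => ?_⟩
  · rw [StahlMarket.rivalTail_subtype (htail x hx)]
    exact E.profit_le i x hx
  · filter_upwards [E.profit_eq i, E.ae_le_reserve i] with x h1 h2
    rwa [StahlMarket.rivalTail_subtype (htail x h2)]
  · have hxr : x ≤ r := by
      by_contra! h
      exact hi.ne' (measure_mono_null (by simpa using h) (E.le_reserve i))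
    rw [StahlMarket.rivalPairTail_subtype (htail x hxr)]
    exact E.no_tie i j x (fun h => hij (Subtype.ext h)) hi hj

/-! ### Parameters of the submarket -/

namespace StahlMarket

variable {ι : Type*} [Fintype ι] [DecidableEq ι] {m : StahlMarket ι}

lemma sum_submarket (m : StahlMarket ι) (s : ℕ) :
    ∑ i : {i // m.stores i = s}, (m.stores i.1 : ℝ) / m.totalStores =
      Fintype.card {i // m.stores i = s} * (s / m.totalStores) := by
  rw [Finset.sum_congr rfl fun i _ => by rw [i.2], Finset.sum_const, nsmul_eq_mul,
    Finset.card_univ]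

lemma submarket_isValid (hm : m.IsValid) {s : ℕ} [Nonempty {i // m.stores i = s}] :
    (m.submarket s).IsValid := by
  obtain ⟨a⟩ := ‹Nonempty {i // m.stores i = s}›
  have : Nonempty ι := ⟨a.1⟩
  have hμ := hm.shoppers_pos
  have hs : 0 < (s : ℝ) := a.2 ▸ hm.stores_cast_pos a.1
  have hk : 0 < (Fintype.card {i // m.stores i = s} : ℝ) :=
    Nat.cast_pos.2 (Fintype.card_pos_iff.2 ⟨a⟩)
  have h : 0 < (1 - m.shoppers) * (Fintype.card {i // m.stores i = s} * (s / m.totalStores)) :=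
    mul_pos (sub_pos.2 hm.shoppers_lt_one) (mul_pos hk (div_pos hs hm.totalStores_pos))
  refine ⟨?_, ?_, hm.searchCost_pos, hm.maxPrice_pos, fun _ => one_pos⟩
  · simp only [submarket, sum_submarket]
    positivity
  · simp only [submarket, sum_submarket]
    rw [div_lt_one (by positivity)]
    linarith

/-- The normalization of the mass of buyers cancels in the ratio of captive buyers to shoppers, so
the pricing game is the same as in the full market. -/
lemma submarket_captive (hm : m.IsValid) {s : ℕ} [Nonempty {i // m.stores i = s}]
    (i : {i // m.stores i = s}) :
    (1 - (m.submarket s).shoppers) * ((m.submarket s).stores i / (m.submarket s).totalStores) =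
      (m.submarket s).shoppers * ((1 - m.shoppers) * (s / m.totalStores) / m.shoppers) := by
  have : Nonempty ι := ⟨i.1⟩
  have hμ := hm.shoppers_pos
  have hs : 0 < (s : ℝ) := i.2 ▸ hm.stores_cast_pos i.1
  have hk : 0 < (Fintype.card {i // m.stores i = s} : ℝ) :=
    Nat.cast_pos.2 (Fintype.card_pos_iff.2 ⟨i⟩)
  have hμ1 := sub_pos.2 hm.shoppers_lt_one
  have hN := hm.totalStores_pos
  have ht : (m.submarket s).totalStores = Fintype.card {i // m.stores i = s} := by
    simp [totalStores, submarket]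
  rw [ht]
  simp only [submarket, sum_submarket, Nat.cast_one]
  set k : ℝ := (Fintype.card {i // m.stores i = s} : ℝ)
  have hD : 0 < m.shoppers + (1 - m.shoppers) * (k * (s / m.totalStores)) := by positivity
  rw [one_sub_div hD.ne', add_sub_cancel_left]
  field_simp

lemma lowestPrice_eq [Nonempty ι] (hm : m.IsValid) {c : ℝ} (hcpos : 0 < c) (r : ℝ)
    (hc : 1 - m.shoppers = Fintype.card ι * (m.shoppers * c)) :
    m.lowestPrice r = r * c / (1 + c) := by
  have hk : 0 < (Fintype.card ι : ℝ) := Nat.cast_pos.2 Fintype.card_pos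
  have hμ := hm.shoppers_pos
  have h1 : ((Fintype.card ι : ℝ) - 1) * m.shoppers + 1 =
      Fintype.card ι * m.shoppers * (1 + c) := by linarith
  rw [lowestPrice, h1, hc]
  field_simp

end StahlMarket

end

/-! ### The theorem -/

theorem theorem2 {ι : Type*} [Fintype ι] [DecidableEq ι] (m : StahlMarket ι) (hm : m.IsValid)
    (s : ℕ) (hmin : ∀ i, s ≤ m.stores i)
    (htwo : ∃ i j, i ≠ j ∧ m.stores i = s ∧ m.stores j = s)
    (r : ℝ) (σ : ι → MeasureTheory.Measure ℝ) (hσ : m.IsReservePriceEquilibrium r σ) :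
    -- every seller with more than `s` stores chooses the reserve price purely
    (∀ i, s < m.stores i → σ i = MeasureTheory.Measure.dirac r) ∧
    -- the smallest sellers play an equilibrium, of the three-group form, of the original model among
    -- the shoppers and the searchers who visit one of them first
    ((m.submarket s).IsValid ∧
      (m.submarket s).IsReservePriceEquilibrium r (fun i => σ i.1) ∧
      (m.submarket s).HasStahlForm r (fun i => σ i.1)) ∧
    -- the profit of a seller is a constant times the number of its stores
    (∀ i, m.profit r σ i = r * (1 - m.shoppers) / m.totalStores * (m.stores i : ℝ)) ∧
    -- almost surely, a searcher accepts the price at the first store visited and buys there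
    (∀ᵐ p ∂(MeasureTheory.Measure.pi σ), ∀ j, p j ≤ r ∧
      ∀ i, m.buyFrom r p j (Finset.univ.erase j) i = if i = j then 1 else 0) := by
  obtain ⟨a, b, hab, ha, hb⟩ := htwo
  have : Nontrivial ι := ⟨a, b, hab⟩
  have : Nontrivial {i // m.stores i = s} := ⟨⟨a, ha⟩, ⟨b, hb⟩, by simpa using hab⟩
  have hμ := hm.shoppers_pos
  have hμ1 := sub_pos.2 hm.shoppers_lt_one
  have hN := hm.totalStores_pos
  have E := hσ.isPricingEquilibrium hm
  have hmono : ∀ i j, m.stores i < m.stores j →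
      (1 - m.shoppers) * (m.stores i / m.totalStores) / m.shoppers <
        (1 - m.shoppers) * (m.stores j / m.totalStores) / m.shoppers := fun i j h => by
    have : (m.stores i : ℝ) < m.stores j := Nat.cast_lt.2 h
    gcongr
  have hmono' : ∀ i j, m.stores i = s →
      (1 - m.shoppers) * (m.stores i / m.totalStores) / m.shoppers ≤
        (1 - m.shoppers) * (m.stores j / m.totalStores) / m.shoppers := fun i j h => by
    rcases (h.trans_le (hmin j)).lt_or_eq with h | h
    · exact (hmono i j h).le
    · rw [h]
  have hπ := E.profit_eq_captive hab (hmono' a · ha) (hmono' b · hb)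
  have hdirac : ∀ i, s < m.stores i → σ i = MeasureTheory.Measure.dirac r := fun i hi =>
    E.eq_dirac_of_captive_lt hπ (hmono a i (ha ▸ hi))
  refine ⟨hdirac, ?_, fun i => ?_, ?_⟩
  · have hm' : (m.submarket s).IsValid := StahlMarket.submarket_isValid hm
    have hr' : (m.submarket s).IsReservePrice r := hσ.reserve
    have hs' : ∀ i : {i // m.stores i = s}, (m.submarket s).IsStrategy (σ i.1) :=
      fun i => hσ.strategy i.1
    set c := (1 - m.shoppers) * (s / m.totalStores) / m.shoppers with hc
    have E' : IsPricingEquilibrium r (fun _ : {i // m.stores i = s} => c) (fun _ => r * c)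
        (fun i => σ i.1) := by
      have h := E.subtype (P := fun i => m.stores i = s)
        fun j hj => hdirac j (lt_of_le_of_ne (hmin j) (Ne.symm hj))
      convert h using 2 with i i
      · rw [hc, i.2]
      · rw [hπ, hc, i.2]
    have hcap := StahlMarket.submarket_captive hm (s := s)
    have hk : (0 : ℝ) < Fintype.card {i // m.stores i = s} := Nat.cast_pos.2 Fintype.card_pos
    have ht : (m.submarket s).totalStores = Fintype.card {i // m.stores i = s} := by
      simp [StahlMarket.totalStores, StahlMarket.submarket]
    -- The searchers of the submarket are the captive buyers of all its sellers together.
    have hcard : 1 - (m.submarket s).shoppers =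
        Fintype.card {i // m.stores i = s} * ((m.submarket s).shoppers * c) := by
      rw [hc, ← hcap ⟨a, ha⟩, ht]
      simp only [StahlMarket.submarket, Nat.cast_one]
      field_simp
    refine ⟨hm', StahlMarket.isReservePriceEquilibrium_of_isPricingEquilibrium hm' hr' hs' E' hcap, ?_,
      fun i => ?_⟩
    · rw [StahlMarket.lowestPrice_eq hm' (E'.captive_pos ⟨a, ha⟩) r hcard]
      exact E'.exists_common_distribution
    · rw [StahlMarket.profit_eq_of_isPricingEquilibrium hm' hs' E' hcap, hcard]
      field_simp
  · have h := hπ i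
    rw [div_eq_iff hμ.ne'] at h
    rw [h]
    field_simp
  · have := hσ.prob
    refine MeasureTheory.ae_all_iff.2 fun j => ?_
    have h : ∀ᵐ p ∂(MeasureTheory.Measure.pi σ), p j ≤ r :=
      (MeasureTheory.Measure.tendsto_eval_ae_ae (μ := σ) (i := j)).eventually
        (E.ae_le_reserve j)
    filter_upwards [h] with p hp using ⟨hp, fun i => StahlMarket.buyFrom_of_le m hp _ i⟩
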